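/- Let $n\ge 2$, let $F_q$ be a finite field of characteristic $p$, and let $G=\mathrm{GL}_n(q)$. Let $B$ and $U$ be the subgroups of upper triangular and upper unitriangular matrices of $G$, and view the symmetric group $S_n$ as the subgroup of permutation matrices of $G$. For $1\le i<n$ let $X_{i,i+1}=\{1+aE^{i,i+1} : a\in F_q\}\subseteq U$ be the fundamental root subgroups. Let $\ell\neq p$ be a prime, let $R$ be a local principal ideal domain of characteristic $0$ with maximal ideal $\ell R$ which contains a primitive $p$-th root of unity, let $R^*$ be its unit group, and let $K=R/\ell R$. Put $$\mathbf e=\sum_{\sigma\in S_n}\mathrm{sg}(\sigma)\,\sigma\sum_{b\in B}b\in RG .$$ Let $I=RG\cdot \mathbf e$ be the left ideal of $RG$ generated by $\mathbf e$ (the Steinberg lattice), and let $L=I/\ell I$ be its reduction modulo $\ell$, a $KG$-module. For a group homomorphism $\lambda:U\to R^*$ put $$E_\lambda=\sum_{u\in U}\lambda(u)\,u\,\mathbf e\in I,\qquad F_\lambda=E_\lambda+\ell I\in L .$$ **Theorem.** Let $\lambda:U\to R^*$ be a group homomorphism that is non-trivial on every fundamental root subgroup $X_{i,i+1}$, $1\le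 i<n$. Then $I=RG\cdot E_\lambda$ and $L=KG\cdot F_\lambda$. Moreover $E_\lambda\ne 0$ and $u\,E_\lambda=\lambda(u)^{-1}E_\lambda$ for all $u\in U$, so that $E_\lambda$ is a generator of $I$ that is a common eigenvector for $U$. Homomorphisms $\lambda:U\to R^*$ that are non-trivial on every fundamental root subgroup exist. -/

import Mathlib

noncomputable section

namespace SteinbergLattice

section Groups

variable (n : ℕ) (F : Type*) [Field F]

/-- The general linear group `G = GL_n(F)`. -/
abbrev GLn : Type _ := Matrix.GeneralLinearGroup (Fin n) F

/-- The subgroup `B` of upper triangular matrices of `GL_n(F)`. -/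
def upperTriangular : Subgroup (GLn n F) where
  carrier := {g | (g : Matrix (Fin n) (Fin n) F).IsUpperTriangular}
  one_mem' := by
    simpa using (Matrix.blockTriangular_one (b := (id : Fin n → Fin n)) (R := F))
  mul_mem' := by
    intro a b ha hb
    simpa using Matrix.BlockTriangular.mul ha hb
  inv_mem' := by
    intro a ha
    have : Invertible (a : Matrix (Fin n) (Fin n) F) := Units.invertible a
    have h := Matrix.blockTriangular_inv_of_blockTriangular
      (M := (a : Matrix (Fin n) (Fin n) F)) (b := (id : Fin n → Fin n)) ha
    simpa [Matrix.coe_units_inv] using h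

variable {n F} in
/-- The diagonal of a product of upper triangular matrices is the product of the diagonals. -/
theorem diag_mul_of_isUpperTriangular {M N : Matrix (Fin n) (Fin n) F}
    (hM : M.IsUpperTriangular) (hN : N.IsUpperTriangular) (i : Fin n) :
    (M * N) i i = M i i * N i i := by
  rw [Matrix.mul_apply]
  refine Finset.sum_eq_single i ?_ (by simp)
  intro k _ hk
  rcases lt_or_gt_of_ne hk with h | h
  · rw [hM h, zero_mul]
  · rw [hN h, mul_zero]

/-- The subgroup `U` of upper unitriangular matrices of `GL_n(F)`. -/
def unitriangular : Subgroup (GLn n F) where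
  carrier := {g | g ∈ upperTriangular n F ∧ ∀ i, (g : Matrix (Fin n) (Fin n) F) i i = 1}
  one_mem' := ⟨one_mem _, by simp⟩
  mul_mem' := by
    rintro a b ⟨ha, ha'⟩ ⟨hb, hb'⟩
    refine ⟨mul_mem ha hb, fun i => ?_⟩
    have h := diag_mul_of_isUpperTriangular ha hb i
    rw [ha' i, hb' i, one_mul] at h
    simpa using h
  inv_mem' := by
    rintro a ⟨ha, ha'⟩
    refine ⟨inv_mem ha, fun i => ?_⟩
    have h := diag_mul_of_isUpperTriangular ha (inv_mem ha) i
    rw [ha' i, one_mul, ← Units.val_mul, mul_inv_cancel] at h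
    simpa using h.symm

instance [Finite F] : Fintype (upperTriangular n F) := Fintype.ofFinite _

instance [Finite F] : Fintype (unitriangular n F) := Fintype.ofFinite _

variable {n} in
/-- The permutation matrix of `σ`, as an element of `GL_n(F)`: it maps the canonical basis
vector `e_j` to `e_{σ j}`, so its `(i, j)` entry is `1` if `i = σ j` and `0` otherwise.
(Mathlib's `Equiv.Perm.permMatrix` is the transpose of this.) -/
def permElement (σ : Equiv.Perm (Fin n)) : GLn n F where
  val := σ⁻¹.permMatrix F
  inv := σ.permMatrix F
  val_inv := by
    rw [← Matrix.permMatrix_mul, mul_inv_cancel, Matrix.permMatrix_one]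
  inv_val := by
    rw [← Matrix.permMatrix_mul, inv_mul_cancel, Matrix.permMatrix_one]

variable {n F} in
/-- The matrix `t_{ij}(a) = 1 + a E^{ij}`, `i ≠ j`, as an element of `GL_n(F)`. -/
def rootElement {i j : Fin n} (hij : i ≠ j) (a : F) : GLn n F where
  val := Matrix.transvection i j a
  inv := Matrix.transvection i j (-a)
  val_inv := by
    rw [Matrix.transvection_mul_transvection_same _ _ hij, add_neg_cancel,
      Matrix.transvection_zero]
  inv_val := by
    rw [Matrix.transvection_mul_transvection_same _ _ hij, neg_add_cancel,
      Matrix.transvection_zero]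

variable {n} in
/-- The root subgroup `X_{ij} = {t_{ij}(a) : a ∈ F}` of `GL_n(F)`, for `i ≠ j`. -/
def rootSubgroup {i j : Fin n} (hij : i ≠ j) : Subgroup (GLn n F) where
  carrier := Set.range (rootElement (F := F) hij)
  one_mem' := ⟨0, Units.ext (Matrix.transvection_zero i j)⟩
  mul_mem' := by
    rintro _ _ ⟨a, rfl⟩ ⟨b, rfl⟩
    exact ⟨a + b, Units.ext (Matrix.transvection_mul_transvection_same i j hij a b).symm⟩
  inv_mem' := by
    rintro _ ⟨a, rfl⟩
    exact ⟨-a, Units.ext rfl⟩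

end Groups

section QuotientRep

variable {R G M : Type*} [CommRing R] [Group G] [AddCommGroup M] [Module R M]

/-- The `R/J`-linear map `M/JM → M/JM`, `x + JM ↦ f x + JM`, induced by an `R`-linear map
`f : M → M`. -/
def quotientMap (J : Ideal R) (f : M →ₗ[R] M) :
    (M ⧸ (J • (⊤ : Submodule R M))) →ₗ[R ⧸ J] (M ⧸ (J • (⊤ : Submodule R M))) :=
  LinearMap.extendScalarsOfSurjective (R := R) (S := R ⧸ J) Ideal.Quotient.mk_surjective
    (Submodule.mapQ (J • (⊤ : Submodule R M)) (J • (⊤ : Submodule R M)) f (by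
      rw [← Submodule.map_le_iff_le_comap, Submodule.map_smul'']
      exact Submodule.smul_mono le_rfl le_top))

theorem quotientMap_mk (J : Ideal R) (f : M →ₗ[R] M) (x : M) :
    quotientMap J f (Submodule.Quotient.mk x) = Submodule.Quotient.mk (f x) :=
  rfl

/-- The representation over `R/J` on `M/JM` induced by a representation over `R` on `M`:
`g (x + JM) = g x + JM`. -/
def quotientRep (ρ : Representation R G M) (J : Ideal R) :
    Representation (R ⧸ J) G (M ⧸ (J • (⊤ : Submodule R M))) where
  toFun g := quotientMap J (ρ g)
  map_one' := by
    refine LinearMap.ext fun x => ?_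
    induction x using Submodule.Quotient.induction_on with
    | H x => rw [quotientMap_mk, map_one]; rfl
  map_mul' g h := by
    refine LinearMap.ext fun x => ?_
    induction x using Submodule.Quotient.induction_on with
    | H x => rw [quotientMap_mk, map_mul, Module.End.mul_apply, Module.End.mul_apply,
        quotientMap_mk, quotientMap_mk]

end QuotientRep

section Lattice

variable (n : ℕ) (F : Type*) [Field F] (R : Type*) [CommRing R]

variable {n F R} in
/-- The homomorphism `lam : U → Rˣ` is non-trivial on each fundamental root subgroup
`X_{i,i+1}` of `GL_n(F)`. -/
def NontrivialOnFundamentalRoots (lam : unitriangular n F →* Rˣ) : Prop :=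
  ∀ (i j : Fin n) (hij : i ≠ j), (j : ℕ) = (i : ℕ) + 1 →
    ∃ u : unitriangular n F, (u : GLn n F) ∈ rootSubgroup F hij ∧ lam u ≠ 1

variable [Finite F]

/-- The element `∑_{σ ∈ S_n} sg(σ) σ (∑_{b ∈ B} b)` of the group algebra `RG`. -/
def steinbergElement : MonoidAlgebra R (GLn n F) :=
  ∑ σ : Equiv.Perm (Fin n),
    ((Equiv.Perm.sign σ : ℤ) : R) •
      (MonoidAlgebra.of R (GLn n F) (permElement F σ) *
        ∑ b : upperTriangular n F, MonoidAlgebra.of R (GLn n F) b)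

/-- The Steinberg lattice: the left ideal `I` of `RG` generated by `steinbergElement`
(for noncommutative rings, Mathlib's `Ideal` means left ideal). -/
def lattice : Ideal (MonoidAlgebra R (GLn n F)) :=
  Ideal.span {steinbergElement n F R}

variable {n F R} in
/-- `E_lam = ∑_{u ∈ U} lam(u) u e`, where `e` is `steinbergElement`. -/
def E (lam : unitriangular n F →* Rˣ) : MonoidAlgebra R (GLn n F) :=
  ∑ u : unitriangular n F,
    (lam u : R) • (MonoidAlgebra.of R (GLn n F) u * steinbergElement n F R)

variable {n F R} in
theorem E_mem_lattice (lam : unitriangular n F →* Rˣ) : E lam ∈ lattice n F R := by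
  refine Submodule.sum_mem _ fun u _ => Submodule.smul_of_tower_mem _ _ ?_
  exact Ideal.mul_mem_left _ _ (Ideal.subset_span rfl)

/-- The representation of `G` over `R` on the lattice `I` by left multiplication. -/
def latticeRep : Representation R (GLn n F) (lattice n F R) where
  toFun g :=
    { toFun := fun x => MonoidAlgebra.of R (GLn n F) g • x
      map_add' := fun x y => smul_add _ x y
      map_smul' := fun r x => smul_comm _ r x }
  map_one' := by
    ext1 x
    exact (congrArg (· • x) (map_one (MonoidAlgebra.of R (GLn n F)))).trans (one_smul _ x)
  map_mul' g h := by
    ext1 x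
    exact (congrArg (· • x) (map_mul (MonoidAlgebra.of R (GLn n F)) g h)).trans (mul_smul _ _ x)

variable (l : ℕ)

/-- The residue ring `K = R/lR`. -/
abbrev ResidueRing : Type _ := R ⧸ Ideal.span {(l : R)}

/-- The underlying `K`-module of the modular reduction `L = I/lI`. -/
abbrev ReductionSpace : Type _ :=
  lattice n F R ⧸
    (Ideal.span {(l : R)} • (⊤ : Submodule R (lattice n F R)))

/-- The representation of `G` over `K = R/lR` on `I/lI` induced by `latticeRep`:
`g (x + lI) = g x + lI`. -/
def reductionRep :
    Representation (ResidueRing R l) (GLn n F) (ReductionSpace n F R l) :=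
  quotientRep (latticeRep n F R) (Ideal.span {(l : R)})

/-- The modular reduction `L = I/lI`, as a module over the group algebra `KG`. -/
abbrev Reduction : Type _ := (reductionRep n F R l).asModule

/-- The canonical projection `I → L = I/lI`. -/
def toReduction (x : lattice n F R) : Reduction n F R l :=
  (reductionRep n F R l).asModuleEquiv.symm (Submodule.Quotient.mk x)

variable {n F R} in
/-- `F_lam = E_lam + lI`, an element of `L`. -/
def FL (lam : unitriangular n F →* Rˣ) : Reduction n F R l :=
  toReduction n F R l ⟨E lam, E_mem_lattice lam⟩

end Lattice

end SteinbergLattice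

end

noncomputable section

namespace SteinbergLattice

open MonoidAlgebra (of)

/-! ### Elementary, diagonal and permutation matrices -/

section Matrices

variable {n : ℕ} {F : Type*} [Field F]

/-! The order of U is a power of p, hence a unit of R, so U-eigenvectors can be split off over R. By
the rank one relation `of_swap_root_mul_steinbergElement`, I is the R-span of the translates u e
with u ∈ U (`lattice_le_unitriangularSpan`). Hence for every linear character μ of U the element ∑
μ(u) u maps I into R·E_μ (`exists_eigenSum_mul_eq_smul_E`).

Let λ be nondegenerate and suppose that M = RG·E_λ is smaller than I. The nonzero module I/M
contains a U-eigenvector whose character depends only on superdiagonal entries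
(`exists_unitriangular_eigenvector`, Fourier analysis column by column). If μ is the inverse
character, ∑ μ(u) u multiplies this vector by the unit |U|, yet maps I into R·E_μ. This is a
contradiction once every E_μ, degenerate or not, lies in M.

The torus permutes the nondegenerate E_μ transitively (`exists_of_mul_E_eq`). A degenerate E_μ is
reached from a nondegenerate one by a permutation w, which reverses the order of the blocks cut out
by the zeros of μ, followed by ∑ μ(u) u (`exists_mul_E_eq`). The surviving terms all equal sg(w) E_μ
and their number is a power of p. The other terms vanish by comparing a single coefficient
(`eigenSum_mul_eq_zero`). The same coefficient shows E_λ ≠ 0. -/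

theorem permElement_mul (σ τ : Equiv.Perm (Fin n)) :
    permElement F (σ * τ) = permElement F σ * permElement F τ := by
  ext1
  simp [permElement, Matrix.permMatrix_mul]

theorem permElement_one : permElement F (1 : Equiv.Perm (Fin n)) = 1 := by
  ext1
  simp [permElement]

theorem permElement_inv (σ : Equiv.Perm (Fin n)) :
    permElement F σ⁻¹ = (permElement F σ)⁻¹ := by
  rw [eq_inv_iff_mul_eq_one, ← permElement_mul, inv_mul_cancel, permElement_one]

theorem permElement_mul_apply (σ : Equiv.Perm (Fin n)) (g : GLn n F) (i j : Fin n) :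
    (permElement F σ * g : GLn n F) i j = g (σ⁻¹ i) j := by
  change ((σ⁻¹).permMatrix F * (g : Matrix (Fin n) (Fin n) F)) i j = _
  rw [Equiv.Perm.permMatrix, PEquiv.toMatrix_toPEquiv_mul]
  rfl

theorem mul_permElement_apply (σ : Equiv.Perm (Fin n)) (g : GLn n F) (i j : Fin n) :
    (g * permElement F σ : GLn n F) i j = g i (σ j) := by
  change ((g : Matrix (Fin n) (Fin n) F) * (σ⁻¹).permMatrix F) i j = _
  rw [Equiv.Perm.permMatrix, PEquiv.mul_toMatrix_toPEquiv]
  rfl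

theorem conj_permElement_apply (σ : Equiv.Perm (Fin n)) (g : GLn n F) (i j : Fin n) :
    (permElement F σ * g * (permElement F σ)⁻¹ : GLn n F) i j = g (σ⁻¹ i) (σ⁻¹ j) := by
  rw [← permElement_inv, mul_permElement_apply, permElement_mul_apply]

theorem mem_upperTriangular {g : GLn n F} :
    g ∈ upperTriangular n F ↔ ∀ i j, j < i → g i j = 0 :=
  ⟨fun h _ _ hij => h hij, fun h i j hij => h i j hij⟩

theorem mem_unitriangular {g : GLn n F} :
    g ∈ unitriangular n F ↔ (∀ i j, j < i → g i j = 0) ∧ ∀ i, g i i = 1 :=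
  and_congr_left' mem_upperTriangular

theorem rootElement_apply {i j : Fin n} (hij : i ≠ j) (a : F) (k l : Fin n) :
    (rootElement hij a : GLn n F) k l =
      (if k = l then 1 else 0) + if i = k ∧ j = l then a else 0 := by
  change Matrix.transvection i j a k l = _
  simp [Matrix.transvection, Matrix.one_apply, Matrix.single_apply]

theorem rootElement_mul_apply {i j : Fin n} (hij : i ≠ j) (a : F) (g : GLn n F) (k l : Fin n) :
    (rootElement hij a * g : GLn n F) k l = g k l + if k = i then a * g j l else 0 := by
  change (Matrix.transvection i j a * (g : Matrix (Fin n) (Fin n) F)) k l = _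
  split_ifs with h
  · subst h; simp
  · simp [h]

theorem rootElement_mem {i j : Fin n} (hij : i < j) (a : F) :
    rootElement hij.ne a ∈ unitriangular n F := by
  rw [mem_unitriangular]
  refine ⟨fun k l h => ?_, fun k => ?_⟩
  · rw [rootElement_apply, if_neg h.ne', if_neg (by rintro ⟨rfl, rfl⟩; exact hij.not_gt h), add_zero]
  · rw [rootElement_apply, if_pos rfl, if_neg (by rintro ⟨rfl, rfl⟩; exact hij.ne rfl), add_zero]

theorem rootElement_neg {i j : Fin n} (hij : i ≠ j) (a : F) :
    (rootElement hij (-a) : GLn n F) = (rootElement hij a)⁻¹ :=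
  Units.ext rfl

theorem rootElement_add {i j : Fin n} (hij : i ≠ j) (a b : F) :
    (rootElement hij (a + b) : GLn n F) = rootElement hij a * rootElement hij b :=
  Units.ext (Matrix.transvection_mul_transvection_same i j hij a b).symm

theorem rootElement_eq_swap_conj {i j : Fin n} (hij : i ≠ j) (a : F) :
    (rootElement hij a : GLn n F) = permElement F (Equiv.swap i j) *
      rootElement hij.symm a * permElement F (Equiv.swap i j) := by
  ext k l
  have h₁ : (j = Equiv.swap i j k ∧ i = Equiv.swap i j l) ↔ (i = k ∧ j = l) := by
    rw [eq_comm, Equiv.swap_apply_eq_iff, Equiv.swap_apply_right, eq_comm (a := i) (b := _ ),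
      Equiv.swap_apply_eq_iff, Equiv.swap_apply_left, eq_comm, eq_comm (a := l)]
  rw [mul_permElement_apply, permElement_mul_apply, rootElement_apply, rootElement_apply,
    Equiv.swap_inv]
  simp only [(Equiv.swap i j).injective.eq_iff, h₁]

theorem rootElement_zero {i j : Fin n} (hij : i ≠ j) : (rootElement hij 0 : GLn n F) = 1 :=
  Units.ext (Matrix.transvection_zero i j)

theorem mul_rootElement_apply {i j : Fin n} (hij : i ≠ j) (a : F) (g : GLn n F) (k l : Fin n) :
    (g * rootElement hij a : GLn n F) k l = g k l + if l = j then a * g k i else 0 := by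
  change ((g : Matrix (Fin n) (Fin n) F) * Matrix.transvection i j a) k l = _
  split_ifs with h
  · subst h; simp
  · simp [h]

/-- The diagonal matrix with entries `d`, as an element of `GL_n(F)`. -/
def diagElement (d : Fin n → Fˣ) : GLn n F where
  val := Matrix.diagonal fun i => (d i : F)
  inv := Matrix.diagonal fun i => ((d i)⁻¹ : Fˣ)
  val_inv := by simp
  inv_val := by simp

theorem diagElement_apply_ne (d : Fin n → Fˣ) {i j : Fin n} (hij : i ≠ j) :
    diagElement d i j = 0 :=
  Matrix.diagonal_apply_ne _ hij

theorem conj_diagElement_apply (d : Fin n → Fˣ) (g : GLn n F) (i j : Fin n) :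
    (diagElement d * g * (diagElement d)⁻¹ : GLn n F) i j = d i * g i j * ((d j)⁻¹ : Fˣ) := by
  rw [Units.val_mul, Units.val_mul, diagElement, Units.inv_mk]
  simp only [Matrix.mul_diagonal, Matrix.diagonal_mul]

theorem conj_diagElement_mem (d : Fin n → Fˣ) {u : GLn n F} (hu : u ∈ unitriangular n F) :
    diagElement d * u * (diagElement d)⁻¹ ∈ unitriangular n F := by
  rw [mem_unitriangular] at hu ⊢
  refine ⟨fun i j hij => ?_, fun i => ?_⟩
  · rw [conj_diagElement_apply, hu.1 _ _ hij, mul_zero, zero_mul]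
  · rw [conj_diagElement_apply, hu.2, mul_one, Units.mul_inv]

/-- Upper unitriangular matrices are products of elementary ones. -/
theorem unitriangular_induction {P : GLn n F → Prop} (one : P 1)
    (mul : ∀ (i j : Fin n) (hij : i < j) (a : F) (g : GLn n F), g ∈ unitriangular n F → P g →
      P (rootElement hij.ne a * g))
    {g : GLn n F} (hg : g ∈ unitriangular n F) : P g := by
  classical
  obtain ⟨N, hN⟩ : ∃ N, N = (Finset.univ.filter fun x : Fin n × Fin n => x.1 < x.2 ∧ g x.1 x.2 ≠ 0).card :=
    ⟨_, rfl⟩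
  induction N using Nat.strong_induction_on generalizing g with
  | _ N ih =>
    set S := Finset.univ.filter fun x : Fin n × Fin n => x.1 < x.2 ∧ g x.1 x.2 ≠ 0 with hS
    rcases S.eq_empty_or_nonempty with h | h
    · have : g = 1 := by
        ext i j
        rw [mem_unitriangular] at hg
        rcases lt_trichotomy i j with hij | rfl | hij
        · by_contra hne
          have : (i, j) ∈ S := by
            rw [hS, Finset.mem_filter]
            refine ⟨Finset.mem_univ _, hij, fun h0 => hne ?_⟩
            rw [h0, Units.val_one, Matrix.one_apply_ne hij.ne]
          simp [h] at this
        · rw [hg.2, Units.val_one, Matrix.one_apply_eq]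
        · rw [hg.1 _ _ hij, Units.val_one, Matrix.one_apply_ne hij.ne']
      rwa [this]
    -- With j the rightmost column that has a nonzero entry above the diagonal, row j of g is
    -- trivial, so the row operation below changes the (i, j) entry only.
    · obtain ⟨⟨i, j⟩, hx, hmax⟩ := S.exists_max_image Prod.snd h
      rw [hS, Finset.mem_filter] at hx
      obtain ⟨-, hij, hne⟩ := hx
      simp only at hij hne hmax
      have hrow : ∀ l, l ≠ j → g j l = 0 := by
        intro l hl
        rcases lt_or_gt_of_ne hl with hl | hl
        · exact (mem_unitriangular.1 hg).1 _ _ hl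
        · by_contra h0
          exact (hmax (j, l) (by rw [hS, Finset.mem_filter]; exact ⟨Finset.mem_univ _, hl, h0⟩)).not_gt hl
      set g' := rootElement hij.ne (-g i j) * g with hg'
      have hg'U : g' ∈ unitriangular n F := mul_mem (rootElement_mem hij _) hg
      have hent : ∀ k l, g' k l = if k = i ∧ l = j then 0 else g k l := by
        intro k l
        rw [hg', rootElement_mul_apply]
        by_cases hk : k = i
        · subst hk
          by_cases hl : l = j
          · subst hl
            simp [(mem_unitriangular.1 hg).2]
          · simp [hl, hrow l hl]
        · simp [hk]
      have hP : P g' := by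
        refine ih _ ?_ hg'U rfl
        rw [hN]
        refine Finset.card_lt_card ⟨fun x hx => ?_, fun hsub => ?_⟩
        · rw [Finset.mem_filter, hent] at hx
          rw [hS, Finset.mem_filter]
          refine ⟨hx.1, hx.2.1, fun h0 => hx.2.2 ?_⟩
          rw [h0, ite_self]
        · have : (i, j) ∈ S := by
            rw [hS, Finset.mem_filter]; exact ⟨Finset.mem_univ _, hij, hne⟩
          have := hsub this
          rw [Finset.mem_filter, hent] at this
          simp at this
      have := mul i j hij (g i j) g' hg'U hP
      rwa [hg', ← mul_assoc, ← rootElement_add, add_neg_cancel, rootElement_zero,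
        one_mul] at this

/-- The group `GL_n(F)` is generated by diagonal matrices, upper unitriangular matrices and
permutation matrices of adjacent transpositions. -/
theorem mem_of_generators (H : Submonoid (GLn n F))
    (hdiag : ∀ d : Fin n → Fˣ, diagElement d ∈ H)
    (hU : ∀ g ∈ unitriangular n F, g ∈ H)
    (hS : ∀ i j : Fin n, (j : ℕ) = i + 1 → permElement F (Equiv.swap i j) ∈ H) (g : GLn n F) :
    g ∈ H := by
  have hperm : ∀ σ : Equiv.Perm (Fin n), permElement F σ ∈ H := by
    rcases n with _ | n
    · intro σ
      rw [Subsingleton.elim σ 1, permElement_one]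
      exact one_mem H
    · intro σ
      have hσ : σ ∈ Submonoid.closure
          (Set.range fun i : Fin n => Equiv.swap i.castSucc i.succ) := by
        rw [Equiv.Perm.mclosure_swap_castSucc_succ]; trivial
      induction hσ using Submonoid.closure_induction with
      | mem x hx =>
        obtain ⟨i, rfl⟩ := hx
        exact hS _ _ (by simp)
      | one => rw [permElement_one]; exact one_mem H
      | mul x y _ _ hx hy => rw [permElement_mul]; exact mul_mem hx hy
  have hroot : ∀ (i j : Fin n) (hij : i ≠ j) (a : F), rootElement hij a ∈ H := by
    intro i j hij a
    rcases lt_or_gt_of_ne hij with h | h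
    · exact hU _ (rootElement_mem h a)
    · rw [rootElement_eq_swap_conj hij]
      exact mul_mem (mul_mem (hperm _) (hU _ (rootElement_mem h a))) (hperm _)
  have key : ∀ M : Matrix (Fin n) (Fin n) F, M.det ≠ 0 → ∀ g : GLn n F,
      (g : Matrix (Fin n) (Fin n) F) = M → g ∈ H := by
    intro M hM
    refine Matrix.diagonal_transvection_induction_of_det_ne_zero
      (fun M => ∀ g : GLn n F, (g : Matrix (Fin n) (Fin n) F) = M → g ∈ H) M hM ?_ ?_ ?_
    · intro D hD g hg
      rw [Matrix.det_diagonal, Finset.prod_ne_zero_iff] at hD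
      rw [show g = diagElement fun i => Units.mk0 (D i) (hD i (Finset.mem_univ i)) from
        Units.ext hg]
      exact hdiag _
    · intro t g hg
      have : g = rootElement t.hij t.c := Units.ext hg
      rw [this]
      exact hroot _ _ _ _
    · intro A B hA hB ihA ihB g hg
      have : g = Matrix.GeneralLinearGroup.mkOfDetNeZero A hA *
          Matrix.GeneralLinearGroup.mkOfDetNeZero B hB := Units.ext hg
      rw [this]
      exact mul_mem (ihA _ rfl) (ihB _ rfl)
  exact key _ (Matrix.GeneralLinearGroup.det_ne_zero g) g rfl

end Matrices

/-! ### The lattice as the R-span of the U-translates of e -/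

section Algebra

variable {n : ℕ} {F : Type*} [Field F] [Finite F] {R : Type*} [CommRing R]

variable (n F R) in
/-- The sum of the elements of `B` in the group algebra. -/
def borelSum : MonoidAlgebra R (GLn n F) :=
  ∑ b : upperTriangular n F, of R (GLn n F) b

theorem steinbergElement_eq : steinbergElement n F R = ∑ σ : Equiv.Perm (Fin n),
    ((Equiv.Perm.sign σ : ℤ) : R) • (of R (GLn n F) (permElement F σ) * borelSum n F R) :=
  rfl

theorem of_mul_borelSum {b : GLn n F} (hb : b ∈ upperTriangular n F) :
    of R (GLn n F) b * borelSum n F R = borelSum n F R := by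
  rw [borelSum, Finset.mul_sum]
  refine Fintype.sum_equiv (Equiv.mulLeft (⟨b, hb⟩ : upperTriangular n F)) _ _ fun x => ?_
  rw [← map_mul]
  rfl

/-- The condition says that σ⁻¹ g σ lies in B, so g stabilises the coset σB. -/
theorem of_mul_perm_mul_borelSum {g : GLn n F} {σ : Equiv.Perm (Fin n)}
    (h : ∀ i j, j < i → g (σ i) (σ j) = 0) :
    of R (GLn n F) g * (of R (GLn n F) (permElement F σ) * borelSum n F R) =
      of R (GLn n F) (permElement F σ) * borelSum n F R := by
  have hb : (permElement F σ)⁻¹ * g * permElement F σ ∈ upperTriangular n F := by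
    rw [mem_upperTriangular]
    intro i j hij
    rw [← permElement_inv, mul_permElement_apply, permElement_mul_apply, inv_inv]
    exact h i j hij
  conv_rhs => rw [← of_mul_borelSum hb]
  rw [← mul_assoc, ← mul_assoc, ← map_mul, ← map_mul]
  congr 2
  group

theorem of_diagElement_mul_steinbergElement (d : Fin n → Fˣ) :
    of R (GLn n F) (diagElement d) * steinbergElement n F R = steinbergElement n F R := by
  rw [steinbergElement_eq, Finset.mul_sum]
  refine Finset.sum_congr rfl fun σ _ => ?_
  rw [mul_smul_comm, of_mul_perm_mul_borelSum]
  exact fun i j hij => diagElement_apply_ne d (σ.injective.ne hij.ne')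

theorem of_perm_mul_steinbergElement (τ : Equiv.Perm (Fin n)) :
    of R (GLn n F) (permElement F τ) * steinbergElement n F R =
      ((Equiv.Perm.sign τ : ℤ) : R) • steinbergElement n F R := by
  rw [steinbergElement_eq, Finset.mul_sum, Finset.smul_sum]
  refine Fintype.sum_equiv (Equiv.mulLeft τ) _ _ fun σ => ?_
  rw [Equiv.coe_mulLeft, mul_smul_comm, ← mul_assoc, ← map_mul, ← permElement_mul, smul_smul,
    Equiv.Perm.sign_mul]
  congr 1
  rcases Int.units_eq_one_or (Equiv.Perm.sign τ) with h | h <;> simp [h]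

/-- The rank one relation `s x(a) e = x(a⁻¹) e - e`. -/
theorem of_swap_root_mul_steinbergElement {k l : Fin n} (hkl : k ≠ l) {a : F} (ha : a ≠ 0) :
    of R (GLn n F) (permElement F (Equiv.swap k l) * rootElement hkl a) * steinbergElement n F R =
      of R (GLn n F) (rootElement hkl a⁻¹) * steinbergElement n F R - steinbergElement n F R := by
  set s := Equiv.swap k l with hs
  have hss : s * s = 1 := Equiv.swap_mul_self k l
  have hsinv : s⁻¹ = s := Equiv.swap_inv k l
  have hpss : permElement F s * permElement F s = 1 := by
    rw [← permElement_mul, hss, permElement_one]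
  set S : Equiv.Perm (Fin n) → MonoidAlgebra R (GLn n F) :=
    fun σ => of R (GLn n F) (permElement F σ) * borelSum n F R with hS
  have hperm : ∀ τ σ, of R (GLn n F) (permElement F τ) * S σ = S (τ * σ) := by
    intro τ σ
    rw [hS]
    simp only
    rw [← mul_assoc, ← map_mul, ← permElement_mul]
  have hroot : ∀ (b : F) (σ : Equiv.Perm (Fin n)), σ⁻¹ k < σ⁻¹ l →
      of R (GLn n F) (rootElement hkl b) * S σ = S σ := by
    intro b σ hσ
    refine of_mul_perm_mul_borelSum fun i j hij => ?_
    rw [rootElement_apply, if_neg (σ.injective.ne hij.ne'), if_neg, add_zero]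
    rintro ⟨hi, hj⟩
    rw [hi, hj, Equiv.Perm.inv_def, Equiv.symm_apply_apply, Equiv.symm_apply_apply] at hσ
    exact hij.not_gt hσ
  -- On the remaining cosets the relation comes from the 2×2 factorisation `h3`, whose last factor
  -- fixes σB by `h2`.
  have hopp : ∀ σ : Equiv.Perm (Fin n), σ⁻¹ k < σ⁻¹ l →
      of R (GLn n F) (permElement F s * rootElement hkl a) * S (s * σ) =
        of R (GLn n F) (rootElement hkl a⁻¹) * S (s * σ) := by
    intro σ hσ
    have h1 : permElement F s * rootElement hkl a * permElement F s =
        (rootElement hkl.symm a : GLn n F) := by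
      rw [hs, Equiv.swap_comm, ← rootElement_eq_swap_conj]
    have h2 : of R (GLn n F) (permElement F s * rootElement hkl (-a⁻¹) * rootElement hkl.symm a) *
        S σ = S σ := by
      refine of_mul_perm_mul_borelSum fun i j hij => ?_
      have hne : σ i ≠ σ j := σ.injective.ne hij.ne'
      have hne' : ¬ (σ i = k ∧ σ j = l) := by
        rintro ⟨hi, hj⟩
        rw [← hi, ← hj, Equiv.Perm.inv_def, Equiv.symm_apply_apply, Equiv.symm_apply_apply] at hσ
        exact hij.not_gt hσ
      rw [mul_assoc, permElement_mul_apply, hsinv, rootElement_mul_apply, rootElement_apply,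
        rootElement_apply]
      generalize σ i = x at hne hne'
      generalize σ j = y at hne hne'
      rw [hs]
      by_cases hxk : x = k
      · subst hxk
        have hyl : y ≠ l := fun h => hne' ⟨rfl, h⟩
        rw [Equiv.swap_apply_left]
        simp [hyl.symm, hne, hkl.symm]
      · by_cases hxl : x = l
        · subst hxl
          rw [Equiv.swap_apply_right]
          by_cases hyk : y = k
          · subst hyk
            simp [ha, hne]
          · simp [hne, Ne.symm hyk, hkl.symm]
        · rw [Equiv.swap_apply_of_ne_of_ne hxk hxl]
          simp [hne, hxk, Ne.symm hxl]
    have h3 : (rootElement hkl.symm a : GLn n F) = rootElement hkl a⁻¹ * permElement F s *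
        (permElement F s * rootElement hkl (-a⁻¹) * rootElement hkl.symm a) := by
      rw [rootElement_neg, mul_assoc, mul_assoc, ← mul_assoc (permElement F s), hpss, one_mul,
        mul_inv_cancel_left]
    rw [← hperm, ← mul_assoc, ← map_mul, h1, h3, map_mul, mul_assoc, h2, map_mul, mul_assoc, hperm]
  rw [eq_sub_iff_add_eq, ← sub_eq_zero, steinbergElement_eq]
  simp only [Finset.mul_sum, mul_smul_comm]
  rw [← Finset.sum_add_distrib, ← Finset.sum_sub_distrib]
  simp only [← smul_add, ← smul_sub]
  -- Both brackets reduce to S (s * σ), and the signs of σ and s * σ are opposite.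
  have hval : ∀ σ : Equiv.Perm (Fin n), σ⁻¹ k < σ⁻¹ l →
      (((Equiv.Perm.sign σ : ℤ) : R) • (of R (GLn n F) (permElement F s * rootElement hkl a) * S σ
        + S σ - of R (GLn n F) (rootElement hkl a⁻¹) * S σ)) +
      (((Equiv.Perm.sign (s * σ) : ℤ) : R) •
        (of R (GLn n F) (permElement F s * rootElement hkl a) * S (s * σ)
        + S (s * σ) - of R (GLn n F) (rootElement hkl a⁻¹) * S (s * σ))) = 0 := by
    intro σ hσ
    rw [hopp σ hσ, add_sub_cancel_left, map_mul, mul_assoc, hroot _ _ hσ, hroot _ _ hσ, hperm,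
      add_sub_cancel_right, Equiv.Perm.sign_mul, hs, Equiv.Perm.sign_swap hkl, ← hs]
    simp
  refine Finset.sum_involution (fun σ _ => s * σ) ?_ ?_ ?_ ?_
  · intro σ _
    rcases lt_or_gt_of_ne (σ⁻¹.injective.ne hkl) with h | h
    · exact hval σ h
    · have := hval (s * σ) (by
        simpa [hs, mul_inv_rev, Equiv.swap_inv] using h)
      rw [← mul_assoc s s, hss, one_mul] at this
      rw [add_comm]
      exact this
  · intro σ _ _ h
    have : s = 1 := by simpa using h
    exact hkl (Equiv.swap_eq_one_iff.1 this)
  · exact fun _ _ => Finset.mem_univ _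
  · intro σ _
    rw [← mul_assoc, hss, one_mul]

variable (n F R) in
/-- The `R`-span of the `U`-translates of the Steinberg element. -/
def unitriangularSpan : Submodule R (MonoidAlgebra R (GLn n F)) :=
  Submodule.span R (Set.range fun u : unitriangular n F =>
    of R (GLn n F) u * steinbergElement n F R)

theorem of_mul_mem_unitriangularSpan {u : GLn n F} (hu : u ∈ unitriangular n F) :
    of R (GLn n F) u * steinbergElement n F R ∈ unitriangularSpan n F R :=
  Submodule.subset_span ⟨⟨u, hu⟩, rfl⟩

/-- It suffices to treat generators. Diagonal matrices normalise U and fix e. For an adjacent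
transposition s, write u = v x(a) with v trivial at the (k, l) entry: then s v s⁻¹ ∈ U, and the rank
one relation rewrites s x(a) e. -/
theorem of_mul_mem_of_mem_unitriangularSpan (g : GLn n F) :
    ∀ z ∈ unitriangularSpan n F R, of R (GLn n F) g * z ∈ unitriangularSpan n F R := by
  let H : Submonoid (GLn n F) :=
    { carrier := {g | ∀ z ∈ unitriangularSpan n F R,
        of R (GLn n F) g * z ∈ unitriangularSpan n F R}
      one_mem' := fun z hz => by rwa [map_one, one_mul]
      mul_mem' := fun {g h} hg hh z hz => by
        rw [map_mul, mul_assoc]; exact hg _ (hh _ hz) }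
  have hH : ∀ g : GLn n F, (∀ u ∈ unitriangular n F, of R (GLn n F) g *
      (of R (GLn n F) u * steinbergElement n F R) ∈ unitriangularSpan n F R) → g ∈ H := by
    intro g hg z hz
    induction hz using Submodule.span_induction with
    | mem x hx =>
      obtain ⟨u, rfl⟩ := hx
      exact hg u u.2
    | zero => rw [mul_zero]; exact zero_mem _
    | add x y _ _ hx hy => rw [mul_add]; exact add_mem hx hy
    | smul r x _ hx => rw [mul_smul_comm]; exact Submodule.smul_mem _ _ hx
  refine mem_of_generators H ?_ ?_ ?_ g
  · intro d
    refine hH _ fun u hu => ?_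
    have := of_mul_mem_unitriangularSpan (R := R) (conj_diagElement_mem d hu)
    rwa [← of_diagElement_mul_steinbergElement d, ← mul_assoc, ← map_mul,
      inv_mul_cancel_right, map_mul, mul_assoc] at this
  · intro g hg
    refine hH g fun u hu => ?_
    rw [← mul_assoc, ← map_mul]
    exact of_mul_mem_unitriangularSpan (mul_mem hg hu)
  · intro k l hkl
    have hlt : k < l := by rw [Fin.lt_def]; omega
    refine hH _ fun u hu => ?_
    set s := Equiv.swap k l with hs
    set v := u * rootElement hlt.ne (-u k l) with hv
    have hvU : v ∈ unitriangular n F := mul_mem hu (rootElement_mem hlt _)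
    have hvkl : v k l = 0 := by
      rw [hv, mul_rootElement_apply, if_pos rfl, (mem_unitriangular.1 hu).2, mul_one,
        add_neg_cancel]
    have hvs : permElement F s * v * (permElement F s)⁻¹ ∈ unitriangular n F := by
      rw [mem_unitriangular] at hvU ⊢
      refine ⟨fun i j hij => ?_, fun i => ?_⟩
      · rw [conj_permElement_apply, hs, Equiv.swap_inv]
        by_cases h : j = k ∧ i = l
        · rw [h.1, h.2, Equiv.swap_apply_left, Equiv.swap_apply_right, hvkl]
        -- Here adjacency matters: s reverses the order of no pair other than (k, l).
        · refine hvU.1 _ _ ?_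
          rw [Equiv.swap_apply_def, Equiv.swap_apply_def]
          split_ifs <;> simp only [Fin.ext_iff, Fin.lt_def] at * <;> omega
      · rw [conj_permElement_apply, hvU.2]
    have hu' : u = v * rootElement hlt.ne (u k l) := by
      rw [hv, rootElement_neg, inv_mul_cancel_right]
    have key : permElement F s * u = permElement F s * v * (permElement F s)⁻¹ *
        (permElement F s * rootElement hlt.ne (u k l)) := by
      conv_lhs => rw [hu']
      group
    rw [← mul_assoc, ← map_mul, key, map_mul, mul_assoc]
    rcases eq_or_ne (u k l) 0 with h0 | h0
    · rw [h0, rootElement_zero, mul_one, of_perm_mul_steinbergElement, mul_smul_comm]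
      exact Submodule.smul_mem _ _ (of_mul_mem_unitriangularSpan hvs)
    · rw [of_swap_root_mul_steinbergElement hlt.ne h0, mul_sub, ← mul_assoc, ← map_mul]
      exact sub_mem (of_mul_mem_unitriangularSpan (mul_mem hvs (rootElement_mem hlt _)))
        (of_mul_mem_unitriangularSpan hvs)

theorem lattice_le_unitriangularSpan {z : MonoidAlgebra R (GLn n F)} (hz : z ∈ lattice n F R) :
    z ∈ unitriangularSpan n F R := by
  obtain ⟨x, rfl⟩ := Submodule.mem_span_singleton.1 hz
  rw [smul_eq_mul]
  induction x using MonoidAlgebra.induction_on with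
  | of g =>
    refine of_mul_mem_of_mem_unitriangularSpan g _ ?_
    have := of_mul_mem_unitriangularSpan (R := R) (one_mem (unitriangular n F))
    rwa [map_one, one_mul] at this
  | add x y hx hy =>
    rw [add_mul]
    exact add_mem (hx (Submodule.mem_span_singleton.2 ⟨x, rfl⟩))
      (hy (Submodule.mem_span_singleton.2 ⟨y, rfl⟩))
  | smul r x hx =>
    rw [smul_mul_assoc]
    exact Submodule.smul_mem _ _ (hx (Submodule.mem_span_singleton.2 ⟨x, rfl⟩))

end Algebra

/-! ### Weighted sums over U -/

section EigenSum

variable {n : ℕ} {F : Type*} [Field F] [Finite F] {R : Type*} [CommRing R]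

/-- The element `∑_{u ∈ U} lam(u) u` of the group algebra. -/
def eigenSum (lam : unitriangular n F →* Rˣ) : MonoidAlgebra R (GLn n F) :=
  ∑ u : unitriangular n F, (lam u : R) • of R (GLn n F) u

theorem E_eq_eigenSum_mul (lam : unitriangular n F →* Rˣ) :
    E lam = eigenSum lam * steinbergElement n F R := by
  simp only [E, eigenSum, Finset.sum_mul, smul_mul_assoc]

theorem of_mul_eigenSum (lam : unitriangular n F →* Rˣ) (u : unitriangular n F) :
    of R (GLn n F) u * eigenSum lam = (((lam u)⁻¹ : Rˣ) : R) • eigenSum lam := by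
  rw [eigenSum, Finset.mul_sum, Finset.smul_sum]
  refine Fintype.sum_equiv (Equiv.mulLeft u) _ _ fun x => ?_
  rw [Equiv.coe_mulLeft, mul_smul_comm, smul_smul, map_mul, Units.val_mul,
    Units.inv_mul_cancel_left, Subgroup.coe_mul, map_mul]

theorem eigenSum_mul_of (lam : unitriangular n F →* Rˣ) (u : unitriangular n F) :
    eigenSum lam * of R (GLn n F) u = (((lam u)⁻¹ : Rˣ) : R) • eigenSum lam := by
  rw [eigenSum, Finset.sum_mul, Finset.smul_sum]
  refine Fintype.sum_equiv (Equiv.mulRight u) _ _ fun x => ?_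
  rw [Equiv.coe_mulRight, smul_mul_assoc, smul_smul, map_mul, Units.val_mul,
    mul_comm (lam x : R), Units.inv_mul_cancel_left, Subgroup.coe_mul, map_mul]

theorem of_mul_E (lam : unitriangular n F →* Rˣ) (u : unitriangular n F) :
    of R (GLn n F) u * E lam = (((lam u)⁻¹ : Rˣ) : R) • E lam := by
  rw [E_eq_eigenSum_mul, ← mul_assoc, of_mul_eigenSum, smul_mul_assoc]

/-- The weighted sum absorbs u on the right up to a scalar, so it sends each u e to a multiple of
E_λ; these translates span I over R. -/
theorem exists_eigenSum_mul_eq_smul_E (lam : unitriangular n F →* Rˣ)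
    {z : MonoidAlgebra R (GLn n F)} (hz : z ∈ lattice n F R) :
    ∃ r : R, eigenSum lam * z = r • E lam := by
  have hz' := lattice_le_unitriangularSpan hz
  clear hz
  induction hz' using Submodule.span_induction with
  | mem x hx =>
    obtain ⟨u, rfl⟩ := hx
    exact ⟨_, by rw [← mul_assoc, eigenSum_mul_of, smul_mul_assoc, ← E_eq_eigenSum_mul]⟩
  | zero => exact ⟨0, by simp⟩
  | add x y _ _ hx hy =>
    obtain ⟨r, hr⟩ := hx
    obtain ⟨s, hs⟩ := hy
    exact ⟨r + s, by rw [mul_add, hr, hs, add_smul]⟩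
  | smul t x _ hx =>
    obtain ⟨r, hr⟩ := hx
    exact ⟨t * r, by rw [mul_smul_comm, hr, smul_smul]⟩

end EigenSum

/-! ### Linear characters of U -/

section LinearCharacters

variable {n : ℕ} {F : Type*} [Field F] {R : Type*} [CommRing R]

/-- The linear form `∑ c_i M_{i,i+1}` in the superdiagonal entries of a matrix. -/
def superdiagForm (c : Fin n → F) (M : Matrix (Fin n) (Fin n) F) : F :=
  ∑ i : Fin n, ∑ j : Fin n, if (j : ℕ) = i + 1 then c i * M i j else 0

/-- By triangularity only the summation indices i and i + 1 contribute to the (i, i + 1) entry of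
the product. -/
theorem superdiagForm_mul (c : Fin n → F) {u v : GLn n F} (hu : u ∈ unitriangular n F)
    (hv : v ∈ unitriangular n F) :
    superdiagForm c (u * v : GLn n F) = superdiagForm c u + superdiagForm c v := by
  rw [mem_unitriangular] at hu hv
  simp only [superdiagForm, ← Finset.sum_add_distrib]
  refine Finset.sum_congr rfl fun i _ => Finset.sum_congr rfl fun j _ => ?_
  split_ifs with h
  · have hij : i ≠ j := fun h' => by rw [h'] at h; omega
    rw [← mul_add, Units.val_mul, Matrix.mul_apply,
      Finset.sum_eq_add_of_mem i j (Finset.mem_univ _) (Finset.mem_univ _) hij, hu.2, hv.2,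
      one_mul, mul_one, add_comm]
    rintro k - ⟨hki, hkj⟩
    rcases lt_or_gt_of_ne hki with hk | hk
    · rw [hu.1 _ _ hk, zero_mul]
    · rw [hv.1 k j, mul_zero]
      simp only [Fin.lt_def, ne_eq, Fin.ext_iff] at *
      omega
  · rw [add_zero]

theorem superdiagForm_one (c : Fin n → F) : superdiagForm c (1 : GLn n F) = 0 := by
  have := superdiagForm_mul c (one_mem (unitriangular n F)) (one_mem (unitriangular n F))
  rwa [one_mul, left_eq_add] at this

theorem superdiagForm_rootElement (c : Fin n → F) {i j : Fin n} (hij : i ≠ j) (a : F) :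
    superdiagForm c (rootElement hij a : GLn n F) = if (j : ℕ) = i + 1 then c i * a else 0 := by
  rw [superdiagForm, Finset.sum_eq_single i, Finset.sum_eq_single j]
  · simp [rootElement_apply, hij]
  · intro l _ hl
    rw [rootElement_apply, if_neg (c := i = i ∧ j = l) (fun h => hl h.2.symm)]
    split_ifs with h h'
    · rw [← h'] at h; omega
    · simp
    · rfl
  · simp
  · intro k _ hk
    refine Finset.sum_eq_zero fun l _ => ?_
    rw [rootElement_apply, if_neg (c := i = k ∧ j = l) (fun h => hk h.1.symm)]
    split_ifs with h h'
    · rw [← h'] at h; omega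
    · simp
    · rfl
  · simp

theorem superdiagForm_neg (c : Fin n → F) (M : Matrix (Fin n) (Fin n) F) :
    superdiagForm (-c) M = -superdiagForm c M := by
  simp only [superdiagForm, ← Finset.sum_neg_distrib]
  refine Finset.sum_congr rfl fun i _ => Finset.sum_congr rfl fun j _ => ?_
  split_ifs <;> simp

/-- The linear character of `U` attached to an additive character `ψ` of `F` and a linear form
in the superdiagonal entries. -/
def linearChar (ψ : AddChar F R) (c : Fin n → F) : unitriangular n F →* Rˣ :=
  MonoidHom.toHomUnits
    { toFun := fun u => ψ (superdiagForm c (u : GLn n F))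
      map_one' := by rw [Subgroup.coe_one, superdiagForm_one, AddChar.map_zero_eq_one]
      map_mul' := fun u v => by
        rw [Subgroup.coe_mul, superdiagForm_mul c u.2 v.2, AddChar.map_add_eq_mul] }

theorem linearChar_apply (ψ : AddChar F R) (c : Fin n → F) (u : unitriangular n F) :
    (linearChar ψ c u : R) = ψ (superdiagForm c (u : GLn n F)) :=
  rfl

/-- If χ differed from all ψ(c ·), orthogonality would kill the sum over a for each c; but summing
over c first isolates a = 0 and leaves |F| ≠ 0. -/
theorem exists_eq_mulShift [Fintype F] [IsDomain R] [CharZero R] {ψ : AddChar F R}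
    (hψ : ψ.IsPrimitive) (χ : AddChar F R) : ∃ c : F, ∀ a, χ a = ψ (c * a) := by
  classical
  by_contra! hne
  have h0 : ∀ c, ∑ a, χ a * ψ (c * -a) = 0 := by
    intro c
    have : χ * ψ.mulShift (-c) ≠ 1 := by
      intro h
      obtain ⟨a, ha⟩ := hne c
      have h' := DFunLike.congr_fun h a
      rw [AddChar.mul_apply, AddChar.mulShift_apply, AddChar.one_apply] at h'
      apply ha
      calc χ a = χ a * (ψ (-c * a) * ψ (c * a)) := by
            rw [← AddChar.map_add_eq_mul, neg_mul, neg_add_cancel, AddChar.map_zero_eq_one, mul_one]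
        _ = _ := by rw [← mul_assoc, h', one_mul]
    rw [← AddChar.sum_eq_zero_of_ne_one this]
    refine Finset.sum_congr rfl fun a _ => ?_
    rw [AddChar.mul_apply, AddChar.mulShift_apply, neg_mul, mul_neg]
  have h1 : ∑ c : F, ∑ a, χ a * ψ (c * -a) = Fintype.card F := by
    rw [Finset.sum_comm]
    simp_rw [← Finset.mul_sum, AddChar.sum_mulShift _ hψ]
    rw [Finset.sum_eq_single 0]
    · simp
    · intro a _ ha
      simp [ha]
    · simp
  rw [Finset.sum_eq_zero fun c _ => h0 c] at h1
  exact Fintype.card_ne_zero (α := F) (by exact_mod_cast h1.symm)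

/-- This exhibits x_ij(a) as a commutator, so homomorphisms from U to commutative groups are trivial
on the non-fundamental root subgroups. -/
theorem rootElement_commutator {i j k : Fin n} (hik : i < k) (hkj : k < j) (a : F) :
    (rootElement hik.ne a * rootElement hkj.ne 1 : GLn n F) =
      rootElement (hik.trans hkj).ne a * (rootElement hkj.ne 1 * rootElement hik.ne a) := by
  have h1 := hik.ne'
  have h2 := hkj.ne'
  have h3 := (hik.trans hkj).ne'
  ext x y
  rw [rootElement_mul_apply, rootElement_mul_apply, rootElement_mul_apply, rootElement_mul_apply]
  simp only [rootElement_apply]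
  simp only [h2, h3.symm, false_and, true_and, if_false, add_zero]
  split_ifs <;> grind

theorem exists_eq_linearChar [Finite F] [IsDomain R] [CharZero R] {ψ : AddChar F R}
    (hψ : ψ.IsPrimitive) {lam : unitriangular n F →* Rˣ}
    (hlam : NontrivialOnFundamentalRoots lam) :
    ∃ c : Fin n → F, (∀ i, c i ≠ 0) ∧ lam = linearChar ψ c := by
  classical
  have := Fintype.ofFinite F
  have hc : ∀ i : Fin n, ∃ c : F, c ≠ 0 ∧ ∀ (j : Fin n) (hij : i < j), (j : ℕ) = i + 1 → ∀ a : F,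
      (lam ⟨rootElement hij.ne a, rootElement_mem hij a⟩ : R) = ψ (c * a) := by
    intro i
    by_cases hi : ∃ j : Fin n, (j : ℕ) = i + 1
    · obtain ⟨j, hj⟩ := hi
      have hij : i < j := by rw [Fin.lt_def]; omega
      let χ : AddChar F R :=
        { toFun := fun a => (lam ⟨rootElement hij.ne a, rootElement_mem hij a⟩ : R)
          map_zero_eq_one' := by
            rw [show (⟨rootElement hij.ne 0, rootElement_mem hij 0⟩ : unitriangular n F) = 1 from
              Subtype.ext (rootElement_zero hij.ne), map_one, Units.val_one]
          map_add_eq_mul' := fun a b => by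
            rw [← Units.val_mul, ← map_mul]
            exact congrArg (fun x => (lam x : R)) (Subtype.ext (rootElement_add hij.ne a b)) }
      obtain ⟨c, hc⟩ := exists_eq_mulShift hψ χ
      refine ⟨c, ?_, fun j' hij' hj' a => ?_⟩
      · rintro rfl
        obtain ⟨u, ⟨a, ha⟩, hu⟩ := hlam i j hij.ne hj
        apply hu
        have h := hc a
        rw [zero_mul, AddChar.map_zero_eq_one] at h
        rw [← Units.val_eq_one, ← h]
        change (lam u : R) = lam _
        congr 2
        exact Subtype.ext ha.symm
      · obtain rfl : j' = j := Fin.ext (hj'.trans hj.symm)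
        exact hc a
    · exact ⟨1, one_ne_zero, fun j _ hj => absurd ⟨j, hj⟩ hi⟩
  choose c hc0 hc using hc
  refine ⟨c, hc0, MonoidHom.ext fun ⟨u, hu⟩ => ?_⟩
  have key : ∀ hu : u ∈ unitriangular n F, lam ⟨u, hu⟩ = linearChar ψ c ⟨u, hu⟩ := by
    refine unitriangular_induction (P := fun u => ∀ hu : u ∈ unitriangular n F,
      lam ⟨u, hu⟩ = linearChar ψ c ⟨u, hu⟩) ?_ ?_ hu
    · intro h
      rw [show (⟨1, h⟩ : unitriangular n F) = 1 from rfl, map_one, map_one]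
    · intro i j hij a g hg ih _
      rw [show (⟨rootElement hij.ne a * g, _⟩ : unitriangular n F) =
        ⟨rootElement hij.ne a, rootElement_mem hij a⟩ * ⟨g, hg⟩ from rfl, map_mul, map_mul, ih hg]
      congr 1
      by_cases hj : (j : ℕ) = i + 1
      · rw [Units.ext_iff, hc i j hij hj, linearChar_apply, superdiagForm_rootElement, if_pos hj]
      · have hik : i < ⟨i + 1, by have := Fin.lt_def.1 hij; omega⟩ := by
          rw [Fin.lt_def]; simp
        have hkj : (⟨i + 1, by have := Fin.lt_def.1 hij; omega⟩ : Fin n) < j := by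
          have := Fin.lt_def.1 hij
          rw [Fin.lt_def]; simp only; omega
        have htriv : ∀ f : unitriangular n F →* Rˣ,
            f ⟨rootElement hij.ne a, rootElement_mem hij a⟩ = 1 := by
          intro f
          have h := congrArg f (Subtype.ext (rootElement_commutator hik hkj a) :
            (⟨rootElement hik.ne a, rootElement_mem hik a⟩ *
              ⟨rootElement hkj.ne 1, rootElement_mem hkj 1⟩ : unitriangular n F) =
            ⟨rootElement hij.ne a, rootElement_mem hij a⟩ *
            (⟨rootElement hkj.ne 1, rootElement_mem hkj 1⟩ *
              ⟨rootElement hik.ne a, rootElement_mem hik a⟩))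
          rw [map_mul, map_mul, map_mul, mul_comm (f ⟨rootElement hkj.ne 1, _⟩)] at h
          exact right_eq_mul.1 h
        rw [htriv, htriv]
  exact key hu

theorem linearChar_nontrivial {ψ : AddChar F R} (hψ : ψ ≠ 1) :
    NontrivialOnFundamentalRoots (linearChar ψ (1 : Fin n → F)) := by
  intro i j hij hj
  obtain ⟨a, ha⟩ := AddChar.ne_one_iff.1 hψ
  have hlt : i < j := by rw [Fin.lt_def]; omega
  refine ⟨⟨rootElement hij a, rootElement_mem hlt a⟩, ⟨a, rfl⟩, fun h => ha ?_⟩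
  rw [Units.ext_iff, linearChar_apply, superdiagForm_rootElement, if_pos hj, Pi.one_apply,
    one_mul] at h
  exact h

end LinearCharacters

/-! ### Torus action on nondegenerate characters -/

section Torus

variable {n : ℕ} {F : Type*} [Field F] [Finite F] {R : Type*} [CommRing R]

/-- The torus permutes the eigenvectors attached to nondegenerate linear characters
transitively. -/
theorem exists_of_mul_E_eq (ψ : AddChar F R) {c c' : Fin n → F} (hc : ∀ i, c i ≠ 0)
    (hc' : ∀ i, c' i ≠ 0) :
    ∃ g : GLn n F, of R (GLn n F) g * E (linearChar ψ c) = E (linearChar ψ c') := by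
  -- Conjugation by d scales the (i, i + 1) entry by d_i / d_{i+1}, which has to be c_i / c'_i.
  set d : Fin n → Fˣ := fun i => ∏ k ∈ Finset.univ.filter (· < i),
    Units.mk0 (c' k) (hc' k) * (Units.mk0 (c k) (hc k))⁻¹ with hd
  have hdsucc : ∀ i j : Fin n, (j : ℕ) = i + 1 → c i * d j = d i * c' i := by
    intro i j hij
    have : Finset.univ.filter (· < j) = insert i (Finset.univ.filter (· < i)) := by
      ext k
      simp only [Finset.mem_filter, Finset.mem_univ, true_and, Finset.mem_insert, Fin.lt_def,
        Fin.ext_iff]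
      omega
    rw [hd]
    simp only
    rw [this, Finset.prod_insert (by simp), Units.val_mul, Units.val_mul, Units.val_inv_eq_inv_val,
      Units.val_mk0, Units.val_mk0]
    field_simp [hc i]
  let f : unitriangular n F → unitriangular n F := fun u =>
    ⟨diagElement d * u * (diagElement d)⁻¹, conj_diagElement_mem d u.2⟩
  have hf : Function.Injective f := fun u v h => by
    simpa [f] using h
  refine ⟨diagElement d, ?_⟩
  rw [E, E, Finset.mul_sum]
  refine Fintype.sum_bijective f (Finite.injective_iff_bijective.1 hf) _ _ fun u => ?_
  have hu : of R (GLn n F) (f u) * steinbergElement n F R =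
      of R (GLn n F) (diagElement d) * (of R (GLn n F) u * steinbergElement n F R) := by
    conv_lhs => rw [← of_diagElement_mul_steinbergElement d, ← mul_assoc, ← map_mul]
    rw [← mul_assoc, ← map_mul, show (f u : GLn n F) * diagElement d = diagElement d * u from
      inv_mul_cancel_right _ _]
  rw [hu, mul_smul_comm, linearChar_apply, linearChar_apply]
  congr 2
  refine Finset.sum_congr rfl fun i _ => Finset.sum_congr rfl fun j _ => ?_
  split_ifs with hij
  · rw [show (f u : GLn n F) i j = d i * (u : GLn n F) i j * ((d j)⁻¹ : Fˣ) from
      conj_diagElement_apply d _ i j, ← mul_assoc, ← mul_assoc, Units.eq_mul_inv_iff_mul_eq]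
    linear_combination ((u : GLn n F) i j) * hdsucc i j hij
  · rfl

end Torus

/-! ### Block reversals and Bruhat uniqueness -/

section Blocks

variable {n : ℕ} {F : Type*} [Field F]

theorem perm_apply_inv_apply (σ : Equiv.Perm (Fin n)) (i : Fin n) : σ (σ⁻¹ i) = i :=
  σ.apply_symm_apply i

theorem perm_inv_apply_apply (σ : Equiv.Perm (Fin n)) (i : Fin n) : σ⁻¹ (σ i) = i :=
  σ.symm_apply_apply i

/-- Both sides have the same sum over k, so no inequality is strict. -/
theorem eq_of_perm_le {b : Fin n → ℕ} {σ : Equiv.Perm (Fin n)} (h : ∀ k, b (σ k) ≤ b k)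
    (k : Fin n) : b (σ k) = b k :=
  (Finset.sum_eq_sum_iff_of_le fun k _ => h k).1 (Equiv.sum_comp σ b) k (Finset.mem_univ k)

open Classical in
/-- The index of the block containing `k`, for the composition of `n` whose blocks end at the
zeros of `c`. -/
def blockIndex (c : Fin n → F) (k : Fin n) : ℕ :=
  (Finset.univ.filter fun i => i < k ∧ c i = 0).card

theorem blockIndex_mono (c : Fin n → F) : Monotone (blockIndex c) := by
  intro k l hkl
  refine Finset.card_le_card fun i hi => ?_
  simp only [Finset.mem_filter, Finset.mem_univ, true_and] at hi ⊢
  exact ⟨hi.1.trans_le hkl, hi.2⟩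

theorem blockIndex_succ_of_ne_zero {c : Fin n → F} {k l : Fin n} (hkl : (l : ℕ) = k + 1)
    (hk : c k ≠ 0) : blockIndex c l = blockIndex c k := by
  rw [blockIndex, blockIndex]
  congr 1
  ext i
  simp only [Finset.mem_filter, Finset.mem_univ, true_and]
  refine and_congr_left fun hi => ?_
  have : (i : ℕ) ≠ k := fun h => hk (Fin.ext h ▸ hi)
  rw [Fin.lt_def, Fin.lt_def]
  omega

theorem blockIndex_succ_of_eq_zero {c : Fin n → F} {k l : Fin n} (hkl : (l : ℕ) = k + 1)
    (hk : c k = 0) : blockIndex c k < blockIndex c l := by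
  refine Finset.card_lt_card (Finset.ssubset_iff_of_subset (fun i hi => ?_) |>.2 ⟨k, ?_, ?_⟩)
  · simp only [Finset.mem_filter, Finset.mem_univ, true_and, Fin.lt_def] at hi ⊢
    exact ⟨by omega, hi.2⟩
  · simp only [Finset.mem_filter, Finset.mem_univ, true_and, Fin.lt_def]
    exact ⟨by omega, hk⟩
  · simp

/-- The permutation `w` reverses the order of the fibres of `b` and preserves the order inside
each fibre. -/
def IsBlockReversal (b : Fin n → ℕ) (w : Equiv.Perm (Fin n)) : Prop :=
  ∀ k l, w⁻¹ k < w⁻¹ l ↔ b l < b k ∨ b k = b l ∧ k < l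

theorem exists_isBlockReversal (b : Fin n → ℕ) : ∃ w, IsBlockReversal b w := by
  -- Sorting by this key lists later blocks first and keeps the order inside each block.
  let f : Fin n → ℕᵒᵈ ×ₗ Fin n := fun k => toLex (OrderDual.toDual (b k), k)
  have hf : Function.Injective f := fun k l h => (Prod.ext_iff.1 (toLex_inj.1 h)).2
  have hmono : StrictMono (f ∘ Tuple.sort f) :=
    (Tuple.monotone_sort f).strictMono_of_injective (hf.comp (Tuple.sort f).injective)
  refine ⟨Tuple.sort f, fun k l => ?_⟩
  rw [← hmono.lt_iff_lt]
  simp only [Function.comp_apply, perm_apply_inv_apply]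
  rw [Prod.Lex.toLex_lt_toLex]
  rfl

/-- A monotone rearrangement of b is unique. Thus w w₀, with w₀ the reversal of all indices,
preserves every block; it reverses the order inside each. -/
theorem IsBlockReversal.comp_rev_eq {b : Fin n → ℕ} (hb : Monotone b) {w : Equiv.Perm (Fin n)}
    (hw : IsBlockReversal b w) (k : Fin n) : b ((w * Fin.revPerm : Equiv.Perm (Fin n)) k) = b k := by
  have h1 : Monotone (b ∘ (w * Fin.revPerm : Equiv.Perm (Fin n))) := by
    intro i j hij
    by_contra! h
    have := (hw (w (Fin.rev i)) (w (Fin.rev j))).2 (Or.inl h)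
    rw [perm_inv_apply_apply, perm_inv_apply_apply, Fin.rev_lt_rev] at this
    exact hij.not_gt this
  have := Tuple.unique_monotone h1 (τ := 1) hb
  exact congrFun this k

/-- Uniqueness in the Bruhat decomposition. -/
theorem eq_of_mul_permElement_mul_eq {v σ : Equiv.Perm (Fin n)} {u b : GLn n F} (hu : u ∈ unitriangular n F)
    (hb : b ∈ upperTriangular n F) (h : u * permElement F σ * b = permElement F v) :
    σ = v ∧ ∀ i j, j < i → (u⁻¹ : GLn n F) (v i) (v j) = 0 := by
  have hu' := mem_unitriangular.1 (inv_mem hu)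
  have hb' : b = permElement F σ⁻¹ * (u⁻¹ * permElement F v) := by
    rw [← h, permElement_inv]; group
  have hent : ∀ i j, j < i → (u⁻¹ : GLn n F) (σ i) (v j) = 0 := by
    intro i j hij
    have := mem_upperTriangular.1 hb i j hij
    rwa [hb', permElement_mul_apply, mul_permElement_apply, inv_inv] at this
  -- The diagonal entries of u⁻¹ are nonzero, so σ⁻¹ v raises no index and must be the identity.
  have hle : ∀ i, (((σ⁻¹ * v) i : Fin n) : ℕ) ≤ (i : ℕ) := by
    intro i
    by_contra! hlt
    have := hent ((σ⁻¹ * v) i) i hlt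
    rw [Equiv.Perm.mul_apply, perm_apply_inv_apply, hu'.2] at this
    exact one_ne_zero this
  have hσ : σ = v := by
    have : σ⁻¹ * v = 1 := Equiv.ext fun i => Fin.ext (eq_of_perm_le (b := fun i => (i : ℕ)) hle i)
    exact inv_mul_eq_one.1 this
  subst hσ
  exact ⟨rfl, hent⟩

end Blocks

/-! ### The coefficient at w w₀ -/

section Coefficients

variable {n : ℕ} {F : Type*} [Field F] [Finite F] {R : Type*} [CommRing R]

theorem exists_of_coeff_steinbergElement_ne_zero {g : GLn n F}
    (h : (steinbergElement n F R).coeff g ≠ 0) :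
    ∃ σ : Equiv.Perm (Fin n), (permElement F σ)⁻¹ * g ∈ upperTriangular n F := by
  classical
  simp only [steinbergElement, Finset.mul_sum, ← map_mul] at h
  simp only [MonoidAlgebra.coeff_sum, Finsupp.finsetSum_apply, MonoidAlgebra.coeff_smul_apply,
    MonoidAlgebra.of_apply, MonoidAlgebra.coeff_single] at h
  obtain ⟨σ, -, hσ⟩ := Finset.exists_ne_zero_of_sum_ne_zero h
  obtain ⟨b, -, hb⟩ := Finset.exists_ne_zero_of_sum_ne_zero (right_ne_zero_of_smul hσ)
  rw [Finsupp.single_apply] at hb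
  split_ifs at hb with hg
  · exact ⟨σ, by rw [← hg, inv_mul_cancel_left]; exact b.2⟩
  · exact absurd rfl hb

/-- Put v = w w₀. In each factorisation u σ b = v, Bruhat uniqueness gives σ = v and makes u⁻¹
vanish at the superdiagonal places where c is nonzero, so the character is 1 at u. The coefficient
is sg(v) times the number of factorisations, which is nonzero in characteristic 0. -/
theorem coeff_E_ne_zero [IsDomain R] [CharZero R] (ψ : AddChar F R) {c : Fin n → F}
    {w : Equiv.Perm (Fin n)} (hw : IsBlockReversal (blockIndex c) w) :
    (E (linearChar ψ c)).coeff (permElement F (w * Fin.revPerm)) ≠ 0 := by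
  classical
  set v := w * Fin.revPerm with hv
  have hterm : ∀ (u : unitriangular n F) (σ : Equiv.Perm (Fin n)) (b : upperTriangular n F),
      (linearChar ψ c u : R) * (((Equiv.Perm.sign σ : ℤ) : R) *
        if (u : GLn n F) * permElement F σ * b = permElement F v then 1 else 0) =
      ((Equiv.Perm.sign v : ℤ) : R) *
        if (u : GLn n F) * permElement F σ * b = permElement F v then 1 else 0 := by
    intro u σ b
    split_ifs with h
    · obtain ⟨rfl, hent⟩ := eq_of_mul_permElement_mul_eq u.2 b.2 h
      have h0 : superdiagForm c (u⁻¹ : GLn n F) = 0 := by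
        refine Finset.sum_eq_zero fun k _ => Finset.sum_eq_zero fun l _ => ?_
        split_ifs with hkl
        · by_cases hk : c k = 0
          · rw [hk, zero_mul]
          · have hlt : w⁻¹ k < w⁻¹ l := (hw k l).2 (Or.inr
              ⟨(blockIndex_succ_of_ne_zero hkl hk).symm, by rw [Fin.lt_def]; omega⟩)
            have := hent (Fin.rev (w⁻¹ k)) (Fin.rev (w⁻¹ l)) (Fin.rev_lt_rev.2 hlt)
            have hvk : ∀ k, v (Fin.rev (w⁻¹ k)) = k := fun k => by
              rw [hv, Equiv.Perm.mul_apply, Fin.revPerm_apply, Fin.rev_rev, perm_apply_inv_apply]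
            rw [hvk, hvk] at this
            rw [this, mul_zero]
        · rfl
      have h1 := superdiagForm_mul c u.2 (inv_mem u.2)
      rw [mul_inv_cancel, superdiagForm_one, h0, add_zero] at h1
      rw [linearChar_apply, ← h1, AddChar.map_zero_eq_one, one_mul]
    · simp
  have hcoeff : (E (linearChar ψ c)).coeff (permElement F v) =
      ((Equiv.Perm.sign v : ℤ) : R) * ((Finset.univ.filter
        fun x : unitriangular n F × Equiv.Perm (Fin n) × upperTriangular n F =>
          (x.1 : GLn n F) * permElement F x.2.1 * x.2.2 = permElement F v).card : R) := by
    simp only [E, steinbergElement, Finset.mul_sum, Finset.smul_sum, mul_smul_comm, ← map_mul,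
      ← mul_assoc]
    simp only [MonoidAlgebra.coeff_sum, Finsupp.finsetSum_apply, MonoidAlgebra.coeff_smul_apply,
      MonoidAlgebra.of_apply, MonoidAlgebra.coeff_single, Finsupp.single_apply, smul_eq_mul]
    simp only [hterm, ← Finset.mul_sum]
    rw [← Finset.sum_boole, Fintype.sum_prod_type]
    simp only [Fintype.sum_prod_type]
  rw [hcoeff]
  refine mul_ne_zero ?_ (Nat.cast_ne_zero.2 (Finset.card_ne_zero.2 ⟨(1, v, 1), ?_⟩))
  · rcases Int.units_eq_one_or (Equiv.Perm.sign v) with h | h <;> simp [h]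
  · simp

/-- The product is a multiple of E_λ, whose coefficient at v = w w₀ is nonzero, so it is enough that
the product has coefficient 0 there. Otherwise y = w u w⁻¹ would be block triangular; as w keeps the
order inside blocks and u is unitriangular, y would lie in U. -/
theorem eigenSum_mul_eq_zero [IsDomain R] [CharZero R] (ψ : AddChar F R) {c : Fin n → F}
    {w : Equiv.Perm (Fin n)} (hw : IsBlockReversal (blockIndex c) w) {u : GLn n F}
    (hu : u ∈ unitriangular n F)
    (huw : permElement F w * u * (permElement F w)⁻¹ ∉ unitriangular n F) :
    eigenSum (linearChar ψ c) * (of R (GLn n F) (permElement F w * u) * steinbergElement n F R) =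
      0 := by
  set b := blockIndex c with hb
  have hbm : Monotone b := blockIndex_mono c
  have hu' := mem_unitriangular.1 hu
  obtain ⟨r, hr⟩ := exists_eigenSum_mul_eq_smul_E (linearChar ψ c)
    (z := of R (GLn n F) (permElement F w * u) * steinbergElement n F R)
    (Ideal.mul_mem_left _ _ (Ideal.subset_span rfl))
  set v := w * Fin.revPerm with hv
  have hcoeff : (eigenSum (linearChar ψ c) * (of R (GLn n F) (permElement F w * u) *
      steinbergElement n F R)).coeff (permElement F v) = 0 := by
    simp only [eigenSum, Finset.sum_mul, smul_mul_assoc, ← mul_assoc, ← map_mul]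
    rw [MonoidAlgebra.coeff_sum, Finsupp.finsetSum_apply]
    refine Finset.sum_eq_zero fun x _ => ?_
    rw [MonoidAlgebra.coeff_smul_apply, MonoidAlgebra.of_apply, MonoidAlgebra.coeff_single_mul_apply,
      one_mul]
    by_contra h
    obtain ⟨σ, hσ⟩ := exists_of_coeff_steinbergElement_ne_zero (right_ne_zero_of_smul h)
    apply huw
    set y := permElement F w * u * (permElement F w)⁻¹ with hy
    set b₀ := (permElement F σ)⁻¹ * (((x : GLn n F) * permElement F w * u)⁻¹ * permElement F v)
      with hb₀
    have hyσ : y * permElement F (w * σ) = (x : GLn n F)⁻¹ * permElement F v * b₀⁻¹ := by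
      rw [hy, hb₀, permElement_mul]
      group
    have hP : Matrix.BlockTriangular (y * permElement F (w * σ) : GLn n F).val b := by
      rw [hyσ, Units.val_mul]
      refine Matrix.BlockTriangular.mul (fun i j hij => ?_) (fun i j hij => ?_)
      · rw [mul_permElement_apply]
        refine (mem_unitriangular.1 (inv_mem x.2)).1 _ _ ?_
        by_contra! hle
        exact (hbm hle).not_gt (by rwa [hv, hw.comp_rev_eq hbm])
      · exact mem_upperTriangular.1 (inv_mem hσ) _ _ (hbm.reflect_lt hij)
    have hyd : ∀ i, y i i = 1 := fun i => by rw [hy, conj_permElement_apply, hu'.2]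
    -- If w σ moved an index to a later block, a diagonal entry 1 of y would land where `hP` demands
    -- 0.
    have hbσ : ∀ k, b ((w * σ) k) = b k := by
      refine eq_of_perm_le fun k => ?_
      by_contra! hlt
      have := hP hlt
      rw [mul_permElement_apply, hyd] at this
      exact one_ne_zero this
    rw [mem_unitriangular]
    refine ⟨fun i j hij => ?_, hyd⟩
    rcases lt_or_ge (w⁻¹ j) (w⁻¹ i) with hlt | hge
    · rw [hy, conj_permElement_apply, hu'.1 _ _ hlt]
    · have hne : w⁻¹ i ≠ w⁻¹ j := w⁻¹.injective.ne hij.ne'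
      rcases (hw i j).1 (lt_of_le_of_ne hge hne) with hlt | ⟨-, hlt⟩
      · have := hP (i := i) (j := (w * σ)⁻¹ j) (by
          rwa [← hbσ, perm_apply_inv_apply])
        rwa [mul_permElement_apply, perm_apply_inv_apply] at this
      · exact absurd hij hlt.not_gt
  rw [hr, MonoidAlgebra.coeff_smul_apply, smul_eq_mul] at hcoeff
  rw [hr, (mul_eq_zero.1 hcoeff).resolve_right (coeff_E_ne_zero ψ hw), zero_smul]

end Coefficients

/-! ### Subgroups of U have invertible order -/

section PGroup

variable {n : ℕ} {F : Type*} [Field F]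

/-- Cayley–Hamilton gives (u - 1)^n = 0; since n < p^n, Frobenius then gives u^(p^n) = 1. -/
theorem isPGroup_unitriangular (p : ℕ) [hp : Fact p.Prime] [CharP F p] :
    IsPGroup p (unitriangular n F) := by
  rintro ⟨u, hu⟩
  have hu' := mem_unitriangular.1 hu
  refine ⟨n, Subtype.ext (Units.ext ?_)⟩
  have h1 : ((u : Matrix (Fin n) (Fin n) F) - 1) ^ n = 0 := by
    have := Matrix.aeval_self_charpoly (u : Matrix (Fin n) (Fin n) F)
    rw [Matrix.charpoly_of_isUpperTriangular _ (mem_upperTriangular.2 hu'.1)] at this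
    simpa [hu'.2] using this
  have h2 : ((u : Matrix (Fin n) (Fin n) F) - 1) ^ p ^ n = 0 :=
    pow_eq_zero_of_le (Nat.lt_pow_self hp.1.one_lt).le h1
  rcases n with _ | n
  · exact Subsingleton.elim _ _
  · rw [sub_pow_char_pow_of_commute (p := p) _ (Commute.one_right _), one_pow, sub_eq_zero] at h2
    simpa using h2

theorem isUnit_card_subgroup {R : Type*} [CommRing R] [Finite F] {p : ℕ} [Fact p.Prime] [CharP F p]
    (hp : IsUnit (p : R)) (H : Subgroup (unitriangular n F)) : IsUnit (Nat.card H : R) := by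
  obtain ⟨k, hk⟩ := IsPGroup.iff_card.1 ((isPGroup_unitriangular (n := n) (F := F) p).to_subgroup H)
  rw [hk, Nat.cast_pow]
  exact hp.pow k

end PGroup

/-! ### Degenerate eigenvectors from nondegenerate ones -/

section Degeneration

variable {n : ℕ} {F : Type*} [Field F]

/-- Neighbours inside a block are the images under w of neighbouring indices, so their entries
match. If w i and w (i + 1) lie in different blocks, then w (i + 1) < w i and the entry vanishes
because w u w⁻¹ is upper triangular; this is why c' is unconstrained there. -/
theorem superdiagForm_conj {c : Fin n → F} {w : Equiv.Perm (Fin n)}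
    (hw : IsBlockReversal (blockIndex c) w) {c' : Fin n → F}
    (hc' : ∀ i, c (w i) ≠ 0 → c' i = c (w i)) {u : GLn n F}
    (huw : permElement F w * u * (permElement F w)⁻¹ ∈ unitriangular n F) :
    superdiagForm c (permElement F w * u * (permElement F w)⁻¹ : GLn n F) = superdiagForm c' u := by
  set b := blockIndex c with hb
  have hbm : Monotone b := blockIndex_mono c
  have hw' : ∀ i j, i < j ↔ b (w j) < b (w i) ∨ b (w i) = b (w j) ∧ w i < w j := by
    intro i j
    rw [← hw, perm_inv_apply_apply, perm_inv_apply_apply]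
  rw [superdiagForm, superdiagForm, ← Equiv.sum_comp w]
  refine Finset.sum_congr rfl fun i _ => ?_
  rw [← Equiv.sum_comp w]
  refine Finset.sum_congr rfl fun j _ => ?_
  have hent : (permElement F w * u * (permElement F w)⁻¹ : GLn n F) (w i) (w j) = u i j := by
    rw [conj_permElement_apply, perm_inv_apply_apply, perm_inv_apply_apply]
  rw [hent]
  have hsq : ∀ k, w i < w k → b (w k) = b (w i) → (j : ℕ) = i + 1 →
      ¬ w k < w j ∨ b (w k) ≠ b (w j) := by
    intro k hik hbk hj
    by_contra! h
    have h1 := (hw' i k).2 (Or.inr ⟨hbk.symm, hik⟩)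
    have h2 := (hw' k j).2 (Or.inr ⟨h.2, h.1⟩)
    simp only [Fin.lt_def] at h1 h2
    omega
  by_cases hwj : (w j : ℕ) = w i + 1
  · have hwlt : w i < w j := by rw [Fin.lt_def]; omega
    rw [if_pos hwj]
    by_cases hci : c (w i) = 0
    · rw [hci, zero_mul, if_neg]
      intro hj
      have : j < i := (hw' j i).2 (Or.inl (blockIndex_succ_of_eq_zero hwj hci))
      rw [Fin.lt_def] at this
      omega
    · have hbb : b (w j) = b (w i) := blockIndex_succ_of_ne_zero hwj hci
      have hij : i < j := (hw' i j).2 (Or.inr ⟨hbb.symm, hwlt⟩)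
      rw [if_pos, hc' i hci]
      by_contra hj
      have hlt := Fin.lt_def.1 hij
      obtain ⟨k, hk⟩ : ∃ k : Fin n, (k : ℕ) = i + 1 := ⟨⟨i + 1, by omega⟩, rfl⟩
      have h1 := (hw' i k).1 (by rw [Fin.lt_def]; omega)
      have h2 := (hw' k j).1 (by rw [Fin.lt_def]; omega)
      simp only [Fin.lt_def] at h1 h2 hwlt
      omega
  · rw [if_neg hwj]
    split_ifs with hj
    · have hij : i < j := by rw [Fin.lt_def]; omega
      rcases lt_or_gt_of_ne (w.injective.ne hij.ne) with hlt | hgt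
      · exfalso
        have hbb : b (w i) = b (w j) := by
          rcases (hw' i j).1 hij with h | h
          · exact absurd (hbm hlt.le) h.not_ge
          · exact h.1
        have hltv := Fin.lt_def.1 hlt
        obtain ⟨k, hk⟩ : ∃ k, (w k : ℕ) = w i + 1 :=
          ⟨w⁻¹ ⟨w i + 1, by omega⟩, by rw [perm_apply_inv_apply]⟩
        have hik : w i < w k := by rw [Fin.lt_def]; omega
        have hkj : w k < w j := by rw [Fin.lt_def]; omega
        have h1 := hbm hik.le
        have h2 := hbm hkj.le
        rcases hsq k hik (by omega) hj with h | h
        · exact h hkj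
        · exact h (by omega)
      · rw [← hent, (mem_unitriangular.1 huw).1 _ _ hgt, mul_zero]
    · rfl

/-- Apply w and then the weighted sum for c to the eigenvector for c', which is c ∘ w with its zeros
replaced by 1. The terms with w u w⁻¹ ∉ U vanish. The others each give sg(w) times the eigenvector
for c, and they are indexed by a subgroup H of U, whose order is a unit. -/
theorem exists_mul_E_eq [Finite F] {R : Type*} [CommRing R] [IsDomain R] [CharZero R]
    {p : ℕ} [Fact p.Prime] [CharP F p] (hp : IsUnit (p : R)) (ψ : AddChar F R)
    (c : Fin n → F) : ∃ c' : Fin n → F, (∀ i, c' i ≠ 0) ∧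
      ∃ z : MonoidAlgebra R (GLn n F), z * E (linearChar ψ c') = E (linearChar ψ c) := by
  classical
  obtain ⟨w, hw⟩ := exists_isBlockReversal (blockIndex c)
  set c' : Fin n → F := fun i => if c (w i) = 0 then 1 else c (w i) with hc'
  refine ⟨c', fun i => ?_, ?_⟩
  · rw [hc']
    simp only
    split_ifs with h
    · exact one_ne_zero
    · exact h
  have hcc : ∀ i, c (w i) ≠ 0 → c' i = c (w i) := fun i hi => if_neg hi
  let H : Subgroup (unitriangular n F) := ((unitriangular n F).comap
    (MulAut.conj (permElement F w)).toMonoidHom).subgroupOf (unitriangular n F)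
  have hterm : ∀ u : unitriangular n F, (linearChar ψ c' u : R) • (eigenSum (linearChar ψ c) *
      (of R (GLn n F) (permElement F w * u) * steinbergElement n F R)) =
      if u ∈ H then ((Equiv.Perm.sign w : ℤ) : R) • E (linearChar ψ c) else 0 := by
    intro u
    split_ifs with h
    · have hy : permElement F w * u * (permElement F w)⁻¹ ∈ unitriangular n F := h
      have hwu : permElement F w * (u : GLn n F) =
          permElement F w * u * (permElement F w)⁻¹ * permElement F w := by group
      have hval : (linearChar ψ c' u : R) = linearChar ψ c ⟨_, hy⟩ := by
        rw [linearChar_apply, linearChar_apply]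
        exact congrArg ψ (superdiagForm_conj hw hcc hy).symm
      have h1 := eigenSum_mul_of (linearChar ψ c) ⟨_, hy⟩
      simp only at h1
      rw [hwu, map_mul, mul_assoc, of_perm_mul_steinbergElement, mul_smul_comm, mul_smul_comm,
        ← mul_assoc, h1, smul_mul_assoc, smul_comm, smul_smul (linearChar ψ c' u : R), hval,
        Units.mul_inv, one_smul, E_eq_eigenSum_mul]
    · rw [eigenSum_mul_eq_zero ψ hw u.2 h, smul_zero]
  have hsum : eigenSum (linearChar ψ c) * of R (GLn n F) (permElement F w) * E (linearChar ψ c') =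
      ((Nat.card H : R) * ((Equiv.Perm.sign w : ℤ) : R)) • E (linearChar ψ c) := by
    rw [E, Finset.mul_sum]
    calc _ = ∑ u : unitriangular n F, (linearChar ψ c' u : R) • (eigenSum (linearChar ψ c) *
          (of R (GLn n F) (permElement F w * u) * steinbergElement n F R)) := by
          refine Finset.sum_congr rfl fun u _ => ?_
          rw [mul_smul_comm, mul_assoc, ← mul_assoc (of R (GLn n F) (permElement F w)), ← map_mul]
      _ = _ := by
          simp_rw [hterm]
          rw [← Finset.sum_filter, Finset.sum_const, ← Nat.cast_smul_eq_nsmul R, smul_smul]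
          congr 3
          rw [Nat.card_eq_fintype_card, Fintype.card_subtype]
  have hunit : IsUnit ((Nat.card H : R) * ((Equiv.Perm.sign w : ℤ) : R)) := by
    refine (isUnit_card_subgroup hp H).mul ?_
    rcases Int.units_eq_one_or (Equiv.Perm.sign w) with h | h <;> simp [h]
  obtain ⟨r, hr⟩ := hunit
  refine ⟨((r⁻¹ : Rˣ) : R) • (eigenSum (linearChar ψ c) * of R (GLn n F) (permElement F w)), ?_⟩
  rw [smul_mul_assoc, hsum, ← hr, smul_smul, Units.inv_mul, one_smul]

end Degeneration

/-! ### Column subgroups of U -/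

section Columns

variable {n : ℕ} {F : Type*} [Field F]

/-- The strictly upper triangular matrix whose only nonzero column is the `j`-th one, with entries
given by `a`. -/
def columnMatrix (j : Fin n) (a : Fin n → F) : Matrix (Fin n) (Fin n) F :=
  Matrix.of fun i l => if l = j ∧ i < j then a i else 0

theorem columnMatrix_apply (j : Fin n) (a : Fin n → F) (i l : Fin n) :
    columnMatrix j a i l = if l = j ∧ i < j then a i else 0 :=
  rfl

theorem columnMatrix_mul_self (j : Fin n) (a b : Fin n → F) :
    columnMatrix j a * columnMatrix j b = 0 := by
  ext i l
  rw [Matrix.mul_apply, Matrix.zero_apply]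
  refine Finset.sum_eq_zero fun k _ => ?_
  rw [columnMatrix_apply, columnMatrix_apply]
  by_cases hk : k = j
  · rw [if_neg (c := l = j ∧ k < j) (fun h => h.2.ne hk), mul_zero]
  · rw [if_neg (fun h => hk h.1), zero_mul]

theorem columnMatrix_add (j : Fin n) (a b : Fin n → F) :
    columnMatrix j (a + b) = columnMatrix j a + columnMatrix j b := by
  ext i l
  rw [Matrix.add_apply, columnMatrix_apply, columnMatrix_apply, columnMatrix_apply]
  split_ifs <;> simp

theorem one_add_columnMatrix_mul (j : Fin n) (a b : Fin n → F) :
    (1 + columnMatrix j a) * (1 + columnMatrix j b) = 1 + columnMatrix j (a + b) := by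
  rw [add_mul, mul_add, mul_add, columnMatrix_mul_self, columnMatrix_add]
  simp only [one_mul, mul_one]
  abel

theorem columnMatrix_zero (j : Fin n) : columnMatrix j (0 : Fin n → F) = 0 := by
  ext i l
  simp [columnMatrix_apply]

/-- The upper unitriangular matrix `1 + columnMatrix j a`, as an element of `GL_n(F)`. -/
def columnElement (j : Fin n) (a : Fin n → F) : GLn n F where
  val := 1 + columnMatrix j a
  inv := 1 + columnMatrix j (-a)
  val_inv := by rw [one_add_columnMatrix_mul, add_neg_cancel, columnMatrix_zero, add_zero]
  inv_val := by rw [one_add_columnMatrix_mul, neg_add_cancel, columnMatrix_zero, add_zero]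

theorem columnElement_apply (j : Fin n) (a : Fin n → F) (i l : Fin n) :
    columnElement j a i l =
      (1 : Matrix (Fin n) (Fin n) F) i l + if l = j ∧ i < j then a i else 0 :=
  rfl

theorem columnElement_add (j : Fin n) (a b : Fin n → F) :
    columnElement j (a + b) = columnElement j a * columnElement j b :=
  Units.ext (one_add_columnMatrix_mul j a b).symm

theorem rootElement_eq_columnElement {i j : Fin n} (hij : i < j) (a : F) :
    rootElement hij.ne a = columnElement j (Pi.single i a) := by
  ext k l
  rw [rootElement_apply, columnElement_apply, Matrix.one_apply]
  congr 1
  by_cases hk : k = i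
  · subst hk
    simp [hij, eq_comm]
  · simp [hk, Ne.symm hk]

/-- The group GL_j in the top left corner normalises the column subgroup and acts on it as on column
vectors. -/
theorem mul_columnElement {j : Fin n} {g : GLn n F}
    (hr : ∀ i l, j ≤ i → g i l = (1 : Matrix (Fin n) (Fin n) F) i l)
    (hc : ∀ i l, j ≤ l → g i l = (1 : Matrix (Fin n) (Fin n) F) i l) (a : Fin n → F) :
    g * columnElement j a = columnElement j (g.val.mulVec a) * g := by
  ext1
  change g.val * (1 + columnMatrix j a) = (1 + columnMatrix j (g.val.mulVec a)) * g.val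
  rw [mul_add, add_mul, mul_one, one_mul]
  congr 1
  ext i l
  rw [Matrix.mul_apply, Matrix.mul_apply, Finset.sum_eq_single j (f := fun k =>
    columnMatrix j (g.val.mulVec a) i k * g k l)]
  · simp only [columnMatrix_apply, true_and]
    rw [hr j l le_rfl]
    by_cases hl : l = j
    · subst hl
      rw [Matrix.one_apply_eq, mul_one]
      split_ifs with hi
      · rw [Matrix.mulVec, dotProduct]
        refine Finset.sum_congr rfl fun k _ => ?_
        simp only [true_and]
        split_ifs with hk
        · rfl
        · rw [hc i k (not_lt.1 hk), Matrix.one_apply_ne (hi.trans_le (not_lt.1 hk)).ne, zero_mul,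
            zero_mul]
      · refine Finset.sum_eq_zero fun k _ => ?_
        simp only [true_and]
        split_ifs with hk
        · rw [hr i k (not_lt.1 hi), Matrix.one_apply_ne (hk.trans_le (not_lt.1 hi)).ne', zero_mul]
        · rw [mul_zero]
    · rw [Matrix.one_apply_ne (Ne.symm hl), mul_zero]
      simp [hl]
  · intro k _ hk
    rw [columnMatrix_apply, if_neg (fun h => hk h.1), zero_mul]
  · simp

/-- The linear form `c_{j-1} a_{j-1}`. -/
def columnForm (c : Fin n → F) (j : Fin n) (a : Fin n → F) : F :=
  ∑ i : Fin n, if (j : ℕ) = i + 1 then c i * a i else 0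

theorem columnForm_congr {c c' : Fin n → F} {j : Fin n} {a a' : Fin n → F}
    (h : ∀ i : Fin n, (j : ℕ) = i + 1 → c i * a i = c' i * a' i) :
    columnForm c j a = columnForm c' j a' := by
  refine Finset.sum_congr rfl fun i _ => ?_
  split_ifs with hi
  · exact h i hi
  · rfl

/-- This moves any nontrivial character of a column subgroup to the standard one. If d_r ≠ 0, put d
into row r of the identity, which gives determinant d_r, and swap rows k and r. -/
theorem exists_row_eq {m : ℕ} {k : Fin n} (hk : (k : ℕ) + 1 = m) {d : Fin n → F} (hd : d ≠ 0)
    (hdm : ∀ i : Fin n, m ≤ i → d i = 0) :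
    ∃ g : GLn n F, (∀ i l : Fin n, m ≤ i → g i l = (1 : Matrix (Fin n) (Fin n) F) i l) ∧
      (∀ i l : Fin n, m ≤ l → g i l = (1 : Matrix (Fin n) (Fin n) F) i l) ∧ ∀ l, g k l = d l := by
  obtain ⟨r, hr⟩ := Function.ne_iff.1 hd
  have hrm : (r : ℕ) < m := by
    by_contra! h
    exact hr (hdm r h)
  have hdet : ((1 : Matrix (Fin n) (Fin n) F).updateRow r d).det ≠ 0 := by
    rw [← Matrix.cramer_transpose_apply, Matrix.transpose_one, Matrix.cramer_one]
    exact hr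
  have hfix : ∀ i : Fin n, m ≤ i → Equiv.swap k r i = i := fun i hi =>
    Equiv.swap_apply_of_ne_of_ne (fun h => by rw [h] at hi; omega)
      (fun h => by rw [h] at hi; omega)
  have hent : ∀ i l, (permElement F (Equiv.swap k r) *
      Matrix.GeneralLinearGroup.mkOfDetNeZero _ hdet : GLn n F) i l =
      (1 : Matrix (Fin n) (Fin n) F).updateRow r d (Equiv.swap k r i) l := fun i l => by
    rw [permElement_mul_apply, Equiv.swap_inv]
    rfl
  refine ⟨permElement F (Equiv.swap k r) * Matrix.GeneralLinearGroup.mkOfDetNeZero _ hdet,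
    fun i l hi => ?_, fun i l hl => ?_, fun l => ?_⟩
  · rw [hent, hfix i hi, Matrix.updateRow_ne]
    rintro rfl
    omega
  · rw [hent]
    by_cases hi : Equiv.swap k r i = r
    · have hik : i = k := by rwa [Equiv.swap_apply_eq_iff, Equiv.swap_apply_right] at hi
      rw [hi, Matrix.updateRow_self, hdm l hl, Matrix.one_apply_ne]
      rintro rfl
      rw [hik] at hl
      omega
    · rw [Matrix.updateRow_ne hi, Matrix.one_apply, Matrix.one_apply]
      have : Equiv.swap k r i = l ↔ i = l := by
        rw [Equiv.swap_apply_eq_iff, hfix l hl]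
      simp only [this]
  · rw [hent, Equiv.swap_apply_left, Matrix.updateRow_self]

end Columns

/-! ### Fourier inversion on F^n -/

section Fourier

variable {n : ℕ} {F : Type*} [Field F] [Fintype F] {R : Type*} [CommRing R] [IsDomain R]
  {N : Type*} [AddCommGroup N] [Module R N]

theorem sum_dotProduct_eq_zero {ψ : AddChar F R} (hψ : ψ.IsPrimitive) {a : Fin n → F}
    (ha : a ≠ 0) : ∑ d : Fin n → F, ψ (d ⬝ᵥ a) = 0 := by
  let χ : AddChar (Fin n → F) R :=
    { toFun := fun d => ψ (d ⬝ᵥ a)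
      map_zero_eq_one' := by rw [zero_dotProduct, AddChar.map_zero_eq_one]
      map_add_eq_mul' := fun d e => by rw [add_dotProduct, AddChar.map_add_eq_mul] }
  refine AddChar.sum_eq_zero_of_ne_one (ψ := χ) ?_
  obtain ⟨i, hi⟩ := Function.ne_iff.1 ha
  obtain ⟨t, ht⟩ := AddChar.ne_one_iff.1 (hψ hi)
  refine AddChar.ne_one_iff.2 ⟨Pi.single i t, ?_⟩
  change ψ (Pi.single i t ⬝ᵥ a) ≠ 1
  rwa [single_dotProduct, mul_comm]

/-- A nonzero vector has a nonzero projection to some eigenspace of an elementary abelian group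
acting linearly. -/
theorem exists_eigenvector_of_add {ψ : AddChar F R} (hψ : ψ.IsPrimitive)
    (hq : IsUnit (Fintype.card F : R)) {ρ : (Fin n → F) → Module.End R N}
    (hρ0 : ρ 0 = 1) (hρ : ∀ a b, ρ (a + b) = ρ a * ρ b) {x : N} (hx : x ≠ 0) :
    ∃ (d : Fin n → F) (r : (Fin n → F) → R), ∑ a, r a • ρ a x ≠ 0 ∧
      ∀ b, ρ b (∑ a, r a • ρ a x) = ψ (d ⬝ᵥ b) • ∑ a, r a • ρ a x := by
  classical
  -- The unnormalised projections of x to the character eigenspaces add up to |F|^n x, so one of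
  -- them is nonzero.
  have hsum : ∑ d : Fin n → F, ∑ a : Fin n → F, ψ (d ⬝ᵥ (-a)) • ρ a x =
      ((Fintype.card F : R) ^ n) • x := by
    rw [Finset.sum_comm]
    simp_rw [← Finset.sum_smul]
    rw [Finset.sum_eq_single 0]
    · simp [hρ0]
    · intro a _ ha
      rw [sum_dotProduct_eq_zero hψ (neg_ne_zero.2 ha), zero_smul]
    · simp
  obtain ⟨d, -, hd⟩ := Finset.exists_ne_zero_of_sum_ne_zero (s := Finset.univ)
    (f := fun d : Fin n → F => ∑ a : Fin n → F, ψ (d ⬝ᵥ (-a)) • ρ a x)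
    (by rw [hsum]; exact fun h => hx ((hq.pow n).smul_eq_zero.1 h))
  refine ⟨d, _, hd, fun b => ?_⟩
  rw [map_sum, Finset.smul_sum]
  refine Fintype.sum_equiv (Equiv.addLeft b) _ _ fun a => ?_
  rw [Equiv.coe_addLeft, map_smul, hρ, Module.End.mul_apply, smul_smul, ← AddChar.map_add_eq_mul,
    ← dotProduct_add]
  rw [neg_add_rev, add_comm (-a), add_neg_cancel_left]

end Fourier

/-! ### Common eigenvectors of U, column by column -/

section Eigenvectors

variable {n : ℕ} {F : Type*} [Field F] {R : Type*} [CommRing R]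
  {N : Type*} [AddCommGroup N] [Module R N]

/-- The vector `x` is a common eigenvector of the unitriangular matrices concentrated in one
column of index at least `m`, for the linear character given by `c`. -/
def IsColumnEigenvector (ρ : Representation R (GLn n F) N) (ψ : AddChar F R) (c : Fin n → F)
    (m : ℕ) (x : N) : Prop :=
  ∀ j : Fin n, m ≤ j → ∀ a, ρ (columnElement j a) x = ψ (columnForm c j a) • x

variable {ρ : Representation R (GLn n F) N} {ψ : AddChar F R}

theorem apply_columnElement_apply {j : Fin n} {g : GLn n F}
    (hr : ∀ i l, j ≤ i → g i l = (1 : Matrix (Fin n) (Fin n) F) i l)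
    (hc : ∀ i l, j ≤ l → g i l = (1 : Matrix (Fin n) (Fin n) F) i l) {x : N}
    {f f' : (Fin n → F) → F} (hf : ∀ a, f' (g.val.mulVec a) = f a)
    (hx : ∀ a, ρ (columnElement j a) x = ψ (f a) • x) (a : Fin n → F) :
    ρ (columnElement j a) (ρ g x) = ψ (f' a) • ρ g x := by
  obtain ⟨b, rfl⟩ : ∃ b, g.val.mulVec b = a :=
    ⟨(g⁻¹ : GLn n F).val.mulVec a, by
      rw [Matrix.mulVec_mulVec, ← Units.val_mul, mul_inv_cancel, Units.val_one, Matrix.one_mulVec]⟩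
  rw [← Module.End.mul_apply, ← map_mul, ← mul_columnElement hr hc, map_mul, Module.End.mul_apply,
    hx, map_smul, hf]

/-- For j > m the character of column j reads only row j - 1 ≥ m, which g leaves unchanged. -/
theorem IsColumnEigenvector.apply {c : Fin n → F} {m : ℕ} {x : N}
    (hx : IsColumnEigenvector ρ ψ c (m + 1) x) {g : GLn n F}
    (hr : ∀ i l : Fin n, m ≤ i → g i l = (1 : Matrix (Fin n) (Fin n) F) i l)
    (hc : ∀ i l : Fin n, m + 1 ≤ l → g i l = (1 : Matrix (Fin n) (Fin n) F) i l) :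
    IsColumnEigenvector ρ ψ c (m + 1) (ρ g x) := by
  intro j hj
  refine apply_columnElement_apply (fun i l h => hr i l ?_) (fun i l h => hc i l ?_)
    (fun a => columnForm_congr fun i hi => ?_) (hx j hj)
  · rw [Fin.le_def] at h; omega
  · rw [Fin.le_def] at h; omega
  · rw [Matrix.mulVec, dotProduct, Finset.sum_congr rfl fun l _ => by rw [hr i l (by omega)]]
    simp [Matrix.one_apply]

theorem exists_isColumnEigenvector_of_succ [Fintype F] [IsDomain R] (hψ : ψ.IsPrimitive)
    (hq : IsUnit (Fintype.card F : R)) {c : Fin n → F} {m : ℕ} (hm : m < n) {x : N} (hx0 : x ≠ 0)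
    (hx : IsColumnEigenvector ρ ψ c (m + 1) x) :
    ∃ (c' : Fin n → F) (y : N), y ≠ 0 ∧ IsColumnEigenvector ρ ψ c' m y := by
  set j : Fin n := ⟨m, hm⟩ with hj
  obtain ⟨d, r, hy0, hy⟩ := exists_eigenvector_of_add hψ hq
    (ρ := fun a => ρ (columnElement j a))
    (by
      have h := columnElement_add j (0 : Fin n → F) 0
      rw [add_zero, left_eq_mul] at h
      simp only [h, map_one])
    (fun a b => by rw [columnElement_add, map_mul]) hx0
  set y := ∑ a, r a • ρ (columnElement j a) x with hydef
  -- Coordinates from m on do not enter `columnElement j`, so a nonzero d i would force a sum of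
  -- character values to annihilate y.
  have hdm : ∀ i : Fin n, m ≤ i → d i = 0 := by
    intro i hi
    by_contra hdi
    have h1 : ∀ t : F, y = ψ (t * d i) • y := by
      intro t
      have h := hy (Pi.single i t)
      have h' : columnElement j (Pi.single i t) = 1 := by
        ext k l
        rw [columnElement_apply, Units.val_one, add_eq_left]
        split_ifs with hk
        · exact Pi.single_eq_of_ne (by
            rintro rfl
            have := Fin.lt_def.1 hk.2
            simp only [hj] at this
            omega) _
        · rfl
      simp only [h', map_one, Module.End.one_apply, dotProduct_single] at h
      rwa [mul_comm] at h
    have h2 : (Fintype.card F : R) • y = 0 := by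
      calc (Fintype.card F : R) • y = ∑ t : F, ψ (t * d i) • y := by
            rw [Finset.sum_congr rfl fun t _ => (h1 t).symm, Finset.sum_const, Finset.card_univ,
              Nat.cast_smul_eq_nsmul]
        _ = 0 := by
          classical
          rw [← Finset.sum_smul, AddChar.sum_mulShift _ hψ, if_neg hdi, Nat.cast_zero, zero_smul]
    exact hy0 (hq.smul_eq_zero.1 h2)
  have hyc : IsColumnEigenvector ρ ψ c (m + 1) y := by
    intro k hk a
    rw [hydef, map_sum, Finset.smul_sum]
    refine Finset.sum_congr rfl fun b _ => ?_
    have := hx.apply (g := columnElement j b) (fun i l hi => ?_) (fun i l hl => ?_) k hk a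
    · rw [map_smul, this, smul_comm]
    · rw [columnElement_apply, add_eq_left, if_neg]
      rintro ⟨-, h⟩
      rw [Fin.lt_def] at h
      simp only [hj] at h
      omega
    · rw [columnElement_apply, add_eq_left, if_neg]
      rintro ⟨h, -⟩
      rw [h] at hl
      simp only [hj] at hl
      omega
  -- An element of GL_m turns d into s times the coordinate m - 1, with s = 0 if d = 0 and s = 1
  -- otherwise. Among the new values with i < m only the one at m - 1 matters for column m.
  obtain ⟨g, s, hgr, hgc, hgs⟩ : ∃ (g : GLn n F) (s : F),
      (∀ i l : Fin n, m ≤ i → g i l = (1 : Matrix (Fin n) (Fin n) F) i l) ∧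
      (∀ i l : Fin n, m ≤ l → g i l = (1 : Matrix (Fin n) (Fin n) F) i l) ∧
      ∀ b, columnForm (fun i => if (i : ℕ) < m then s else c i) j (g.val.mulVec b) = d ⬝ᵥ b := by
    rcases eq_or_ne d 0 with hd | hd
    · refine ⟨1, 0, fun _ _ _ => rfl, fun _ _ _ => rfl, fun b => ?_⟩
      rw [hd, zero_dotProduct]
      refine Finset.sum_eq_zero fun i _ => ?_
      split_ifs with h1
      · simp only [hj] at h1
        simp only [if_pos (show (i : ℕ) < m by omega), zero_mul]
      · rfl
    · obtain ⟨i, hi⟩ := Function.ne_iff.1 hd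
      have him : (i : ℕ) < m := by
        by_contra! h
        exact hi (hdm i h)
      obtain ⟨k, hk⟩ : ∃ k : Fin n, (k : ℕ) + 1 = m := ⟨⟨m - 1, by omega⟩, by simp only; omega⟩
      obtain ⟨g, hgr, hgc, hgk⟩ := exists_row_eq hk hd hdm
      refine ⟨g, 1, hgr, hgc, fun b => ?_⟩
      rw [columnForm, Finset.sum_eq_single k]
      · rw [if_pos hk.symm, if_pos (by omega), one_mul, Matrix.mulVec, dotProduct, dotProduct]
        exact Finset.sum_congr rfl fun l _ => by rw [hgk]
      · intro l _ hl
        rw [if_neg]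
        intro h
        apply hl
        ext
        simp only [hj] at h
        omega
      · simp
  refine ⟨fun i => if (i : ℕ) < m then s else c i, ρ g y, fun h => hy0 ?_, fun k hk => ?_⟩
  · rw [← Module.End.one_apply (R := R) y, ← map_one ρ, ← inv_mul_cancel g, map_mul,
      Module.End.mul_apply, h, map_zero]
  · rcases eq_or_lt_of_le hk with hk | hk
    · obtain rfl : k = j := Fin.ext hk.symm
      exact apply_columnElement_apply (fun i l h => hgr i l h) (fun i l h => hgc i l h) hgs hy
    · intro a
      rw [hyc.apply hgr (fun i l h => hgc i l (by omega)) k hk a]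
      congr 2
      refine columnForm_congr fun i hi => ?_
      rw [if_neg (by omega)]

/-- Every nonzero representation of `GL_n(F)` contains a common eigenvector of `U` on which `U`
acts by a linear character in the superdiagonal entries. -/
theorem exists_unitriangular_eigenvector [Fintype F] [IsDomain R] [Nontrivial N]
    (ρ : Representation R (GLn n F) N) (hψ : ψ.IsPrimitive)
    (hq : IsUnit (Fintype.card F : R)) :
    ∃ (c : Fin n → F) (y : N), y ≠ 0 ∧
      ∀ u ∈ unitriangular n F, ρ u y = ψ (superdiagForm c (u : GLn n F)) • y := by
  -- Columns are treated from the last to the first; k counts those already done.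
  have key : ∀ k ≤ n, ∃ (c : Fin n → F) (y : N), y ≠ 0 ∧ IsColumnEigenvector ρ ψ c (n - k) y := by
    intro k
    induction k with
    | zero =>
      intro _
      obtain ⟨x, hx⟩ := exists_ne (0 : N)
      exact ⟨0, x, hx, fun j hj => absurd j.2 (by omega)⟩
    | succ k ih =>
      intro hk
      obtain ⟨c, y, hy, hyc⟩ := ih (by omega)
      rw [show n - k = n - (k + 1) + 1 by omega] at hyc
      exact exists_isColumnEigenvector_of_succ hψ hq (by omega) hy hyc
  obtain ⟨c, y, hy, hyc⟩ := key n le_rfl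
  refine ⟨c, y, hy, fun u hu => ?_⟩
  refine unitriangular_induction (P := fun u => ρ u y = ψ (superdiagForm c u) • y) ?_ ?_ hu
  · rw [map_one, superdiagForm_one, AddChar.map_zero_eq_one, one_smul, Module.End.one_apply]
  · intro i j hij a g hg ih
    rw [map_mul, Module.End.mul_apply, ih, map_smul, superdiagForm_mul c (rootElement_mem hij a) hg,
      superdiagForm_rootElement, rootElement_eq_columnElement hij, hyc j (by omega), smul_smul,
      ← AddChar.map_add_eq_mul,
      add_comm]
    congr 3
    rw [columnForm, Finset.sum_eq_single i]
    · simp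
    · intro k _ hk
      simp [hk]
    · simp

end Eigenvectors

/-! ### Generation of the lattice -/

section Generation

variable {n : ℕ} {F : Type*} [Field F] [Finite F] {R : Type*} [CommRing R] [IsDomain R]
  [CharZero R] {p : ℕ} [Fact p.Prime] [CharP F p]

theorem E_mem_of_nondegenerate (hp : IsUnit (p : R)) (ψ : AddChar F R) {c : Fin n → F}
    (hc : ∀ i, c i ≠ 0) (c' : Fin n → F) :
    E (linearChar ψ c') ∈ Ideal.span {E (linearChar ψ c)} := by
  obtain ⟨c'', hc'', z, hz⟩ := exists_mul_E_eq hp ψ c'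
  obtain ⟨g, hg⟩ := exists_of_mul_E_eq ψ hc hc''
  rw [← hz, ← hg]
  exact Ideal.mul_mem_left _ _ (Ideal.mul_mem_left _ _ (Ideal.subset_span rfl))

theorem lattice_eq_span_E (hp : IsUnit (p : R)) {ψ : AddChar F R} (hψ : ψ.IsPrimitive)
    {c : Fin n → F} (hc : ∀ i, c i ≠ 0) :
    lattice n F R = Ideal.span {E (linearChar ψ c)} := by
  have := Fintype.ofFinite F
  set M : Ideal (MonoidAlgebra R (GLn n F)) := Ideal.span {E (linearChar ψ c)} with hM
  have hMle : M ≤ lattice n F R := (Ideal.span_singleton_le_iff_mem _).2 (E_mem_lattice _)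
  refine le_antisymm ?_ hMle
  by_contra hle
  set M' : Submodule (MonoidAlgebra R (GLn n F)) (lattice n F R) :=
    Submodule.comap (lattice n F R).subtype M with hM'
  have hnt : Nontrivial (lattice n F R ⧸ M') := by
    rw [Submodule.Quotient.nontrivial_iff]
    intro htop
    exact hle fun z hz => (htop ▸ Submodule.mem_top : (⟨z, hz⟩ : lattice n F R) ∈ M')
  have hq : IsUnit (Fintype.card F : R) := by
    obtain ⟨k, -, hk⟩ := FiniteField.card F p
    rw [hk, Nat.cast_pow]
    exact hp.pow _
  obtain ⟨d, y, hy, hyd⟩ := exists_unitriangular_eigenvector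
    (Representation.ofModule' (k := R) (G := GLn n F) (lattice n F R ⧸ M')) hψ hq
  obtain ⟨⟨z, hz⟩, rfl⟩ := Submodule.Quotient.mk_surjective _ y
  have hact : ∀ (g : GLn n F) (v : lattice n F R ⧸ M'),
      Representation.ofModule' (k := R) (G := GLn n F) (lattice n F R ⧸ M') g v =
        of R (GLn n F) g • v := fun g v => rfl
  have hcard : IsUnit (Nat.card (unitriangular n F) : R) := by
    have := isUnit_card_subgroup hp (⊤ : Subgroup (unitriangular n F))
    rwa [Subgroup.card_top] at this
  -- The character of -d is inverse to that of the eigenvector, so each of the |U| terms contributes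
  -- the vector itself.
  have h1 : eigenSum (linearChar ψ (-d)) • (Submodule.Quotient.mk ⟨z, hz⟩ : lattice n F R ⧸ M') =
      (Nat.card (unitriangular n F) : R) • Submodule.Quotient.mk ⟨z, hz⟩ := by
    rw [eigenSum, Finset.sum_smul]
    have : ∀ u : unitriangular n F, ((linearChar ψ (-d) u : R) • of R (GLn n F) u) •
        (Submodule.Quotient.mk ⟨z, hz⟩ : lattice n F R ⧸ M') = Submodule.Quotient.mk ⟨z, hz⟩ := by
      intro u
      rw [smul_assoc, ← hact, hyd u u.2, smul_smul, linearChar_apply, superdiagForm_neg,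
        ← AddChar.map_add_eq_mul, neg_add_cancel, AddChar.map_zero_eq_one, one_smul]
    rw [Finset.sum_congr rfl fun u _ => this u, Finset.sum_const, Finset.card_univ,
      Nat.card_eq_fintype_card, Nat.cast_smul_eq_nsmul]
  -- The same element maps I into multiples of an eigenvector that lies in M, although -d may be
  -- degenerate.
  have h2 : eigenSum (linearChar ψ (-d)) • (Submodule.Quotient.mk ⟨z, hz⟩ : lattice n F R ⧸ M') =
      0 := by
    rw [← Submodule.Quotient.mk_smul, Submodule.Quotient.mk_eq_zero]
    obtain ⟨r, hr⟩ := exists_eigenSum_mul_eq_smul_E (linearChar ψ (-d)) hz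
    change eigenSum (linearChar ψ (-d)) * z ∈ M
    rw [hr]
    exact Submodule.smul_of_tower_mem _ _ (E_mem_of_nondegenerate hp ψ hc _)
  rw [h2] at h1
  exact hy (hcard.smul_eq_zero.1 h1.symm)

end Generation

/-! ### Passage to the reduction modulo l -/

section Reduction

variable {n : ℕ} {F : Type*} [Field F] [Finite F] {R : Type*} [CommRing R] {l : ℕ}

theorem toReduction_of_smul (g : GLn n F) (x : lattice n F R) :
    toReduction n F R l (of R (GLn n F) g • x) =
      of (ResidueRing R l) (GLn n F) g • toReduction n F R l x := by
  rw [MonoidAlgebra.of_apply (R := ResidueRing R l), Representation.single_smul, one_smul]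
  rfl

theorem toReduction_add (x y : lattice n F R) :
    toReduction n F R l (x + y) = toReduction n F R l x + toReduction n F R l y :=
  rfl

theorem toReduction_smul (r : R) (x : lattice n F R) :
    toReduction n F R l (r • x) =
      (MonoidAlgebra.single 1 (Ideal.Quotient.mk _ r) :
        MonoidAlgebra (ResidueRing R l) (GLn n F)) • toReduction n F R l x := by
  rw [Representation.single_smul, map_one, Module.End.one_apply]
  rfl

/-- The projection I → L is surjective and compatible with the actions of the two group algebras, so
a generator maps to a generator. -/
theorem top_eq_span_FL {lam : unitriangular n F →* Rˣ}
    (h : lattice n F R = Ideal.span {E lam}) :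
    (⊤ : Submodule (MonoidAlgebra (ResidueRing R l) (GLn n F)) (Reduction n F R l)) =
      Submodule.span _ {FL l lam} := by
  refine (eq_top_iff.2 fun y _ => ?_).symm
  obtain ⟨x, rfl⟩ : ∃ x, toReduction n F R l x = y := Submodule.Quotient.mk_surjective _ y
  have key : ∀ (z : MonoidAlgebra R (GLn n F)),
      toReduction n F R l (z • ⟨E lam, E_mem_lattice lam⟩) ∈
        Submodule.span (MonoidAlgebra (ResidueRing R l) (GLn n F)) {FL l lam} := by
    intro z
    induction z using MonoidAlgebra.induction_on with
    | of g =>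
      rw [toReduction_of_smul]
      exact Submodule.smul_mem _ _ (Submodule.subset_span rfl)
    | add a b ha hb =>
      rw [add_smul, toReduction_add]
      exact add_mem ha hb
    | smul r a ha =>
      rw [smul_assoc, toReduction_smul]
      exact Submodule.smul_mem _ _ ha
  have hx : (x : MonoidAlgebra R (GLn n F)) ∈ Ideal.span {E lam} := h.le x.2
  obtain ⟨z, hz⟩ := Submodule.mem_span_singleton.1 hx
  have : x = z • ⟨E lam, E_mem_lattice lam⟩ := Subtype.ext hz.symm
  rw [this]
  exact key z

end Reduction

/-! ### A primitive additive character of F -/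

section Characters

variable {F : Type*} [Field F] [Finite F] {R : Type*} [CommRing R]

/-- Compose the character of the prime field given by ζ with the trace; over a field a nontrivial
additive character is primitive. -/
theorem exists_isPrimitive_addChar {p : ℕ} [Fact p.Prime] [CharP F p] {ζ : R}
    (hζ : IsPrimitiveRoot ζ p) : ∃ ψ : AddChar F R, ψ ≠ 1 ∧ ψ.IsPrimitive := by
  obtain rfl : p = ringChar F :=
    (CharP.ringChar_of_prime_eq_zero Fact.out (CharP.cast_eq_zero F p)).symm
  have : NeZero (ringChar F) := ⟨(Fact.out : (ringChar F).Prime).ne_zero⟩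
  let _ : Algebra (ZMod (ringChar F)) F := ZMod.algebra F _
  have hχ := AddChar.zmodChar_primitive_of_primitive_root _ hζ
  set χ : AddChar (ZMod (ringChar F)) R :=
    AddChar.zmodChar _ ((IsPrimitiveRoot.iff_def ζ _).mp hζ).left
  obtain ⟨a, ha⟩ := FiniteField.trace_to_zmod_nondegenerate F (one_ne_zero (α := F))
  rw [one_mul] at ha
  have h1 : χ.compAddMonoidHom (Algebra.trace (ZMod (ringChar F)) F).toAddMonoidHom ≠ 1 :=
    AddChar.ne_one_iff.2 ⟨a, fun h => ha ((hχ.zmod_char_eq_one_iff _ _).1 h)⟩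
  exact ⟨_, h1, AddChar.IsPrimitive.of_ne_one h1⟩

end Characters

end SteinbergLattice

end

theorem mainTheorem4 (n : ℕ) (hn : 2 ≤ n) (F : Type*) [Field F] [Finite F]
    (p : ℕ) [CharP F p] (l : ℕ) (hl : l.Prime) (hlp : l ≠ p)
    (R : Type*) [CommRing R] [IsDomain R] [IsPrincipalIdealRing R] [IsLocalRing R] [CharZero R]
    (hR : IsLocalRing.maximalIdeal R = Ideal.span {(l : R)})
    (hζ : ∃ ζ : R, IsPrimitiveRoot ζ p) :
    (∀ lam : SteinbergLattice.unitriangular n F →* Rˣ,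
      SteinbergLattice.NontrivialOnFundamentalRoots lam →
        SteinbergLattice.lattice n F R = Ideal.span {SteinbergLattice.E lam} ∧
        (⊤ : Submodule (MonoidAlgebra (SteinbergLattice.ResidueRing R l)
            (SteinbergLattice.GLn n F)) (SteinbergLattice.Reduction n F R l)) =
          Submodule.span _ {SteinbergLattice.FL l lam} ∧
        SteinbergLattice.E lam ≠ 0 ∧
        ∀ u : SteinbergLattice.unitriangular n F,
          MonoidAlgebra.of R (SteinbergLattice.GLn n F) u * SteinbergLattice.E lam =
            (((lam u)⁻¹ : Rˣ) : R) • SteinbergLattice.E lam) ∧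
    ∃ lam : SteinbergLattice.unitriangular n F →* Rˣ,
      SteinbergLattice.NontrivialOnFundamentalRoots lam := by
  have hpp : p.Prime := (CharP.char_is_prime_or_zero F p).resolve_right
    (CharP.char_ne_zero_of_finite F p)
  have : Fact p.Prime := ⟨hpp⟩
  -- Otherwise the maximal ideal would contain the coprime integers l and p.
  have hp : IsUnit (p : R) := by
    by_contra h
    have hpm : (p : R) ∈ IsLocalRing.maximalIdeal R := (IsLocalRing.mem_maximalIdeal _).2 h
    have hlm : (l : R) ∈ IsLocalRing.maximalIdeal R := hR ▸ Ideal.mem_span_singleton_self _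
    have hcop : IsCoprime (l : ℤ) (p : ℤ) :=
      Nat.isCoprime_iff_coprime.2 ((Nat.coprime_primes hl hpp).2 hlp)
    obtain ⟨a, b, hab⟩ := hcop
    have hab' : (a : R) * l + b * p = 1 := by exact_mod_cast congrArg (Int.cast : ℤ → R) hab
    exact (Ideal.ne_top_iff_one _).1 (IsLocalRing.maximalIdeal.isMaximal R).ne_top
      (hab' ▸ add_mem (Ideal.mul_mem_left _ _ hlm) (Ideal.mul_mem_left _ _ hpm))
  obtain ⟨ζ, hζ⟩ := hζ
  obtain ⟨ψ, hψ1, hψ⟩ := SteinbergLattice.exists_isPrimitive_addChar (F := F) hζ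
  refine ⟨fun lam hlam => ?_, _, SteinbergLattice.linearChar_nontrivial hψ1⟩
  obtain ⟨c, hc, rfl⟩ := SteinbergLattice.exists_eq_linearChar hψ hlam
  have hspan := SteinbergLattice.lattice_eq_span_E hp hψ hc
  refine ⟨hspan, SteinbergLattice.top_eq_span_FL hspan, fun h0 => ?_,
    SteinbergLattice.of_mul_E _⟩
  obtain ⟨w, hw⟩ := SteinbergLattice.exists_isBlockReversal (SteinbergLattice.blockIndex c)
  refine SteinbergLattice.coeff_E_ne_zero ψ hw ?_
  rw [h0]
  rfl
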